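/- Fix an even, non-negative function $\chi\in C_0^\infty((-2,2))$ with $\chi(s)=1$ for $|s|\le 1$. For $n\ge 1$ and $j\in\mathbb Z$ let $\psi(\xi)=\chi(|\xi|)-\chi(2|\xi|)$ and $\psi_j(\xi)=\psi(2^{-j}\xi)$ for $\xi\in\mathbb R^n$, and let $P_j$ be the Fourier multiplier on $L^2(\mathbb R^n)$ given by $\widehat{P_ju}(\xi)=\psi_j(\xi)\,\widehat u(\xi)$, where $\widehat f(\xi)=c_0\int_{\mathbb R^n}e^{-ix\cdot\xi}f(x)\,dx$ with a fixed normalizing constant $c_0\neq 0$. For signs $\varepsilon_1,\dots,\varepsilon_n\in\{1,-1\}$ put $|\xi|_\pm^2=\sum_{i=1}^n\varepsilon_i\xi_i^2$, and let $W_\pm(t)$, $t\in\mathbb R$, be the operator on $L^2(\mathbb R^n)$ given by $\widehat{W_\pm(t)\phi}(\xi)=e^{-it|\xi|_\pm^2}\,\widehat\phi(\xi)$. For a unit vector $\mathbf e\in\mathbb S^{n-1}$ let $P_{\mathbf e}=\{v\in\mathbb R^n: v\cdot\mathbf e=0\}$, and for a measurable function $u(t,x)$ on $\mathbb R\times\mathbb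 R^n$ and $p\in[1,\infty]$ let $$\|u\|_{L^{p,\infty}_{\mathbf e}}=\Big\|\,r\mapsto \operatorname*{ess\,sup}_{(v,t)\in P_{\mathbf e}\times\mathbb R}|u(t,r\mathbf e+v)|\,\Big\|_{L^p(\mathbb R)} .$$ **Lemma (maximal function estimate).** There is a constant $C$, depending only on $\chi$, such that for all integers $n\ge 2$, all $p\in[2,\infty]$ with $np\ge 6$, all signs $\varepsilon_1,\dots,\varepsilon_n$, all $\mathbf e\in\mathbb S^{n-1}$, all $j\in\mathbb Z$ and all $\phi\in L^2(\mathbb R^n)$, $$2^{-\left(\frac n2-\frac1p\right)j}\,\big\|P_jW_\pm(t)\phi\big\|_{L^{p,\infty}_{\mathbf e}}\le C\,\|\phi\|_{L^2(\mathbb R^n)}$$ (with $1/p=0$ for $p=\infty$). Here $P_jW_\pm(t)\phi$ is regarded as a function of $(t,x)$: it has a representative that is continuous on $\mathbb R\times\mathbb R^n$, and the estimate holds for every jointly measurable representative. -/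

import Mathlib

open MeasureTheory
open scoped ENNReal NNReal FourierTransform ContDiff

noncomputable section

namespace NonellipticSchrodinger

/-- The Euclidean space `ℝⁿ`. -/
abbrev Eucl (n : ℕ) : Type := EuclideanSpace ℝ (Fin n)

/-- The complex Hilbert space `L²(ℝⁿ)`. -/
abbrev L2 (n : ℕ) : Type := Lp ℂ 2 (volume : Measure (Eucl n))

/-- A cutoff `χ ∈ C₀^∞((-2,2))`, even, non-negative, with `χ(s) = 1` for `|s| ≤ 1`. -/
structure Cutoff where
  toFun : ℝ → ℝ
  smooth : ContDiff ℝ ∞ toFun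
  tsupport_subset : tsupport toFun ⊆ Set.Ioo (-2) 2
  even : ∀ s, toFun (-s) = toFun s
  nonneg : ∀ s, 0 ≤ toFun s
  eq_one : ∀ s, |s| ≤ 1 → toFun s = 1

/-- The Littlewood-Paley symbol `ψ_j(ξ) = ψ(2^{-j} ξ)`, where `ψ(ξ) = χ(|ξ|) - χ(2|ξ|)`. -/
def lpSymbol {n : ℕ} (χ : Cutoff) (j : ℤ) (ξ : Eucl n) : ℂ :=
  ((χ.toFun ‖(2 : ℝ) ^ (-j) • ξ‖ - χ.toFun (2 * ‖(2 : ℝ) ^ (-j) • ξ‖) : ℝ) : ℂ)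

/-- The quadratic form `|ξ|²_± = ∑ ε_i ξ_i²`. -/
def quadForm {n : ℕ} (ε : Fin n → ℝ) (ξ : Eucl n) : ℝ := ∑ i, ε i * ξ i ^ 2

/-- The symbol `exp(-i t |ξ|²_±)` of the Schrödinger group. -/
def schrodingerSymbol {n : ℕ} (ε : Fin n → ℝ) (t : ℝ) (ξ : Eucl n) : ℂ :=
  Complex.exp (-Complex.I * (t : ℂ) * (quadForm ε ξ : ℂ))

/-- A measurable bounded symbol. -/
structure IsSymbol {n : ℕ} (m : Eucl n → ℂ) : Prop where
  measurable : Measurable m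
  bounded : ∃ C : ℝ, ∀ ξ, ‖m ξ‖ ≤ C

theorem isSymbol_lpSymbol {n : ℕ} (χ : Cutoff) (j : ℤ) :
    IsSymbol (lpSymbol (n := n) χ j) := by
  have hc : Continuous χ.toFun := χ.smooth.continuous
  have hs : HasCompactSupport χ.toFun :=
    (isCompact_Icc (a := (-2 : ℝ)) (b := 2)).of_isClosed_subset (isClosed_tsupport _)
      (χ.tsupport_subset.trans Set.Ioo_subset_Icc_self)
  obtain ⟨C, hC⟩ := hs.exists_bound_of_continuous hc
  refine ⟨Continuous.measurable ?_, C + C, fun ξ => ?_⟩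
  · unfold lpSymbol
    fun_prop
  · rw [lpSymbol, Complex.norm_real]
    exact (norm_sub_le _ _).trans (add_le_add (hC _) (hC _))

theorem isSymbol_schrodingerSymbol {n : ℕ} (ε : Fin n → ℝ) (t : ℝ) :
    IsSymbol (schrodingerSymbol ε t) := by
  refine ⟨Continuous.measurable ?_, 1, fun ξ => ?_⟩
  · unfold schrodingerSymbol quadForm
    fun_prop
  · have h : -Complex.I * (t : ℂ) * (quadForm ε ξ : ℂ)
        = ((-(t * quadForm ε ξ) : ℝ) : ℂ) * Complex.I := by
      push_cast
      ring
    rw [schrodingerSymbol, h, Complex.norm_exp_ofReal_mul_I]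

theorem memLp_symbol_mul {n : ℕ} {m : Eucl n → ℂ} (hm : IsSymbol m) (f : L2 n) :
    MemLp (fun ξ => m ((2 * Real.pi) • ξ) * f ξ) 2 volume := by
  obtain ⟨C, hC⟩ := hm.bounded
  have hm' : Measurable fun ξ : Eucl n => m ((2 * Real.pi) • ξ) :=
    hm.measurable.comp (measurable_const_smul _)
  exact (Lp.memLp f).of_le_mul (c := C)
    (hm'.aestronglyMeasurable.mul (Lp.aestronglyMeasurable f))
    (Filter.Eventually.of_forall fun ξ => by
      rw [norm_mul]
      exact mul_le_mul_of_nonneg_right (hC _) (norm_nonneg _))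

/-- The Fourier multiplier on `L²(ℝⁿ)` with the bounded symbol `m`, the symbol being written in
the frequency variable dual to `x` through `exp(-i x·ξ)`. Mathlib's `𝓕` uses `exp(-2πi x·ξ)`, so
that the symbol is evaluated at `2πξ`. The operator does not depend on the normalizing constant in
front of the Fourier integral. -/
def fourierMultiplier {n : ℕ} (m : Eucl n → ℂ) (hm : IsSymbol m) (f : L2 n) : L2 n :=
  𝓕⁻ ((memLp_symbol_mul hm (𝓕 f)).toLp : L2 n)

/-- The Littlewood-Paley projection `P_j` on `L²(ℝⁿ)`. -/
def lpProj {n : ℕ} (χ : Cutoff) (j : ℤ) (f : L2 n) : L2 n :=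
  fourierMultiplier (lpSymbol χ j) (isSymbol_lpSymbol χ j) f

/-- The (non-elliptic) Schrödinger group `W_±(t)` on `L²(ℝⁿ)`. -/
def schrodinger {n : ℕ} (ε : Fin n → ℝ) (t : ℝ) (f : L2 n) : L2 n :=
  fourierMultiplier (schrodingerSymbol ε t) (isSymbol_schrodingerSymbol ε t) f

/-- The hyperplane `P_e = {v : v·e = 0}`. -/
abbrev hyperplane {n : ℕ} (e : Eucl n) : Submodule ℝ (Eucl n) := (Submodule.span ℝ {e})ᗮ

/-- Lebesgue measure on the hyperplane `P_e`, a Euclidean space of its own. (The instance is given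
explicitly: the measure that the subset `P_e` inherits from `ℝⁿ` would be zero.) -/
def hyperplaneMeasure {n : ℕ} (e : Eucl n) : Measure (hyperplane e) :=
  (measureSpaceOfInnerProductSpace : MeasureSpace (hyperplane e)).volume

/-- The norm of `L^{p,q}_e(ℝ × ℝⁿ)`: the `L^p` norm in `r ∈ ℝ` of the `L^q` norm in
`(v, t) ∈ P_e × ℝ` of `u(t, r e + v)`; for an infinite exponent it is the essential supremum. -/
def mixedNorm {n : ℕ} (e : Eucl n) (p q : ℝ≥0∞) (u : ℝ → Eucl n → ℂ) : ℝ≥0∞ :=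
  eLpNorm (fun r : ℝ =>
    eLpNorm (fun y : hyperplane e × ℝ => u y.2 (r • e + (y.1 : Eucl n))) q
      ((hyperplaneMeasure e).prod volume)) p volume

/-- The function `u` of `(t, x)` represents the family `v` of elements of `L²(ℝⁿ)`: it is jointly
measurable (up to a null set), and `u(t, ·)` is a representative of `v(t)` for every `t`. -/
def Represents {n : ℕ} (u : ℝ → Eucl n → ℂ) (v : ℝ → L2 n) : Prop :=
  AEStronglyMeasurable (Function.uncurry u) (volume : Measure (ℝ × Eucl n)) ∧
    ∀ t : ℝ, u t =ᵐ[volume] v t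

end NonellipticSchrodinger

end

open MeasureTheory
open scoped ENNReal NNReal FourierTransform ContDiff

noncomputable section

namespace NonellipticSchrodinger

/-! ### The Fresnel integral -/

/-! The proof is a `T T*` argument. The value of `P_j W_±(t) φ` at `x` is the inner product of `φ̂`
with a vector `wave χ ε j (t, x)` of `L²`, and the inner product of two such vectors is the kernel
`propKernel` of `P_j² W_±` at the difference of the two space-time points. The heart of the matter
is the bound `|K_j(t, x)| ≤ A 2^{jn} (1 + 2^j |x·e|)^{-d/2}` for `d ≤ min(n, 3)`, uniform in `t` and
in the component of `x` orthogonal to `e` (`exists_norm_propKernel_le`).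

After rescaling to unit frequency, put `r = |x·e|`. If `8|t| ≤ r`, the phase is non-stationary in
the direction `e`, and two rounds of integration by parts give `r⁻²`. If `r < 8|t|`, dispersion in
`d` coordinates gives `|t|^{-d/2}`. The signs are harmless: each coordinate carries a Fresnel phase
of curvature `±2t`, and only the modulus matters. Using at most three coordinates keeps the number
of derivatives of the cutoff bounded. The remaining growth `4^n`, the volume of a cube around the
frequency support, is absorbed by the factor `(2π)^{-n}` of the Fourier normalization, so the
constant does not depend on `n`.

Since the bound sees only the difference of the `e`-components, it survives when a point of the
hyperplane `x·e = r` is selected for each `r`. Linearizing the supremum in this way, duality and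
Young's inequality bound the `L^p` norm of the maximal function by the square root of the `L^{p/2}`
norm of the majorant (`lintegral_iSup_enorm_inner_rpow_le`). The majorant raised to the power `p/2`
decays with exponent `dp/4 ≥ 3/2`, hence is integrable: for `n ≥ 3` because `p ≥ 2`, for `n = 2`
because `np ≥ 6`. Finally, any representative agrees almost everywhere with the continuous one, also
on almost every slice, and there a countable dense set controls the essential supremum. -/

theorem norm_cexp_I_mul_ofReal (x : ℝ) : ‖Complex.exp (Complex.I * (x : ℂ))‖ = 1 := by
  rw [mul_comm, Complex.norm_exp_ofReal_mul_I]

/-- Integration by parts with `E = (E'/(2cs))`, `c = iσ`: the boundary terms contribute `1/(2b) +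
1/2` and the remainder at most `1/2 - 1/(2b)`, which add up to exactly 1. -/
theorem norm_integral_cexp_sq_one_le {σ : ℝ} (hσ : |σ| = 1) {b : ℝ} (hb : 1 ≤ b) :
    ‖∫ s in (1 : ℝ)..b, Complex.exp (Complex.I * ((σ * s ^ 2 : ℝ) : ℂ))‖ ≤ 1 := by
  set c : ℂ := Complex.I * (σ : ℂ) with hc
  have hc1 : ‖c‖ = 1 := by simp [hc, hσ]
  have hc0 : c ≠ 0 := by
    intro h
    simp [h] at hc1
  set E : ℝ → ℂ := fun s => Complex.exp (Complex.I * ((σ * s ^ 2 : ℝ) : ℂ)) with hE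
  have hE1 : ∀ s, ‖E s‖ = 1 := fun s => norm_cexp_I_mul_ofReal _
  have hEc : Continuous E := by
    simp only [hE]
    fun_prop
  have hpos : ∀ s ∈ Set.uIcc (1 : ℝ) b, 0 < s := by
    intro s hs
    rw [Set.uIcc_of_le hb] at hs
    linarith [hs.1]
  have hder : ∀ s ∈ Set.uIcc (1 : ℝ) b,
      HasDerivAt (fun s : ℝ => E s / (2 * c * (s : ℂ))) (E s - E s / (2 * c * (s : ℂ) ^ 2)) s := by
    intro s hs
    have hs0 : (s : ℂ) ≠ 0 := by exact_mod_cast (hpos s hs).ne'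
    have h1 : HasDerivAt (fun s : ℝ => (s : ℂ)) 1 s := Complex.ofRealCLM.hasDerivAt
    have h2 : HasDerivAt E (E s * (c * (2 * (s : ℂ)))) s := by
      have h3 : HasDerivAt (fun s : ℝ => c * (s : ℂ) ^ 2) (c * (2 * (s : ℂ))) s := by
        simpa using (h1.pow 2).const_mul c
      have h4 := h3.cexp
      have : E = fun s : ℝ => Complex.exp (c * (s : ℂ) ^ 2) := by
        funext s
        simp only [hE, hc]
        congr 1
        push_cast
        ring
      rw [this]
      exact h4
    refine (h2.div (h1.const_mul (2 * c)) (by simp [hc0, hs0])).congr_deriv ?_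
    field_simp
  have hci : ContinuousOn (fun s : ℝ => E s / (2 * c * (s : ℂ) ^ 2)) (Set.uIcc (1 : ℝ) b) := by
    refine hEc.continuousOn.div (by fun_prop) ?_
    intro s hs
    have hs0 : (s : ℂ) ≠ 0 := by exact_mod_cast (hpos s hs).ne'
    simp [hc0, hs0]
  have hInt := hci.intervalIntegrable (μ := volume)
  have hftc := intervalIntegral.integral_eq_sub_of_hasDerivAt hder
    ((hEc.intervalIntegrable _ _).sub hInt)
  rw [intervalIntegral.integral_sub (hEc.intervalIntegrable _ _) hInt] at hftc
  have hder2 : ∀ s ∈ Set.uIcc (1 : ℝ) b,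
      HasDerivAt (fun s : ℝ => -(2 * s)⁻¹) ((2 * s ^ 2)⁻¹) s := by
    intro s hs
    have hs0 : s ≠ 0 := (hpos s hs).ne'
    refine ((((hasDerivAt_id s).const_mul 2).inv (by simpa using hs0)).neg).congr_deriv ?_
    simp only [id]
    field_simp
  have hci2 : ContinuousOn (fun s : ℝ => (2 * s ^ 2)⁻¹) (Set.uIcc (1 : ℝ) b) := by
    refine ContinuousOn.inv₀ (by fun_prop) ?_
    intro s hs
    have := hpos s hs
    positivity
  have hftc2 := intervalIntegral.integral_eq_sub_of_hasDerivAt hder2 hci2.intervalIntegrable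
  have hbound : ‖∫ s in (1 : ℝ)..b, E s / (2 * c * (s : ℂ) ^ 2)‖
      ≤ ∫ s in (1 : ℝ)..b, (2 * s ^ 2)⁻¹ := by
    refine intervalIntegral.norm_integral_le_of_norm_le hb
      (Filter.Eventually.of_forall fun s _ => ?_) hci2.intervalIntegrable
    simp [hE1, hc1]
  rw [hftc2] at hbound
  have hb0 : 0 < b := by linarith
  have heq : ∫ s in (1 : ℝ)..b, E s = E b / (2 * c * (b : ℂ)) - E 1 / (2 * c * ((1 : ℝ) : ℂ))
      + ∫ s in (1 : ℝ)..b, E s / (2 * c * (s : ℂ) ^ 2) := by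
    rw [← hftc]
    ring
  rw [heq]
  have e1 : ‖E b / (2 * c * (b : ℂ))‖ = (2 * b)⁻¹ := by
    simp [hE1, hc1, abs_of_pos hb0]
  have e2 : ‖E 1 / (2 * c * ((1 : ℝ) : ℂ))‖ = 2⁻¹ := by
    rw [norm_div, hE1]
    simp [hc1]
  calc _ ≤ _ := (norm_add_le _ _).trans (add_le_add (norm_sub_le _ _) hbound)
    _ ≤ 1 := by
      rw [e1, e2]
      apply le_of_eq
      ring

theorem norm_integral_cexp_sq_zero_le {σ : ℝ} (hσ : |σ| = 1) {b : ℝ} (hb : 0 ≤ b) :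
    ‖∫ s in (0 : ℝ)..b, Complex.exp (Complex.I * ((σ * s ^ 2 : ℝ) : ℂ))‖ ≤ 2 := by
  have hcont : Continuous fun s : ℝ => Complex.exp (Complex.I * ((σ * s ^ 2 : ℝ) : ℂ)) := by
    fun_prop
  have hsmall : ∀ a : ℝ, 0 ≤ a → a ≤ 1 →
      ‖∫ s in (0 : ℝ)..a, Complex.exp (Complex.I * ((σ * s ^ 2 : ℝ) : ℂ))‖ ≤ 1 := by
    intro a ha ha1
    refine (intervalIntegral.norm_integral_le_of_norm_le_const (C := 1) fun s _ =>
      (norm_cexp_I_mul_ofReal _).le).trans ?_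
    simpa [abs_of_nonneg ha] using ha1
  rcases le_total b 1 with h | h
  · linarith [hsmall b hb h]
  · rw [← intervalIntegral.integral_add_adjacent_intervals (hcont.intervalIntegrable 0 1)
      (hcont.intervalIntegrable 1 b)]
    refine (norm_add_le _ _).trans ?_
    linarith [hsmall 1 zero_le_one le_rfl, norm_integral_cexp_sq_one_le hσ h]

theorem norm_integral_cexp_sq_le {σ : ℝ} (hσ : |σ| = 1) (a b : ℝ) :
    ‖∫ s in a..b, Complex.exp (Complex.I * ((σ * s ^ 2 : ℝ) : ℂ))‖ ≤ 4 := by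
  have hcont : Continuous fun s : ℝ => Complex.exp (Complex.I * ((σ * s ^ 2 : ℝ) : ℂ)) := by
    fun_prop
  have key : ∀ b : ℝ, ‖∫ s in (0 : ℝ)..b, Complex.exp (Complex.I * ((σ * s ^ 2 : ℝ) : ℂ))‖ ≤ 2 := by
    intro b
    rcases le_total 0 b with h | h
    · exact norm_integral_cexp_sq_zero_le hσ h
    · have h1 := intervalIntegral.integral_comp_neg (a := 0) (b := b)
        (fun s : ℝ => Complex.exp (Complex.I * ((σ * s ^ 2 : ℝ) : ℂ)))
      simp only [neg_sq, neg_zero] at h1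
      rw [h1, intervalIntegral.integral_symm, norm_neg]
      exact norm_integral_cexp_sq_zero_le hσ (by linarith)
  rw [← intervalIntegral.integral_interval_sub_left (hcont.intervalIntegrable 0 b)
    (hcont.intervalIntegrable 0 a)]
  refine (norm_sub_le _ _).trans ?_
  linarith [key a, key b]

/-- The second derivative test for a quadratic phase. -/
theorem norm_integral_cexp_quadratic_le (x : ℝ) {τ : ℝ} (hτ : τ ≠ 0) (a b : ℝ) :
    ‖∫ s in a..b, Complex.exp (Complex.I * ((x * s - τ * s ^ 2 : ℝ) : ℂ))‖ ≤ 4 / √|τ| := by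
  set l : ℝ := √|τ| with hl
  have hl0 : 0 < l := Real.sqrt_pos.mpr (abs_pos.mpr hτ)
  have hl2 : l ^ 2 = |τ| := Real.sq_sqrt (abs_nonneg _)
  set σ : ℝ := -(τ / |τ|) with hσ'
  have hσ : |σ| = 1 := by
    rw [hσ', abs_neg, abs_div, abs_abs, div_self (abs_pos.mpr hτ).ne']
  have hστ : σ * l ^ 2 = -τ := by
    rw [hl2, hσ']
    field_simp [(abs_pos.mpr hτ).ne']
  -- Completing the square; the scale `l = √|τ|` reduces the phase to `±s²`, and its inverse is the
  -- gain.
  have hpt : ∀ s : ℝ, Complex.exp (Complex.I * ((x * s - τ * s ^ 2 : ℝ) : ℂ))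
      = Complex.exp (Complex.I * ((x ^ 2 / (4 * τ) : ℝ) : ℂ)) *
        Complex.exp (Complex.I * ((σ * (l * s - l * (x / (2 * τ))) ^ 2 : ℝ) : ℂ)) := by
    intro s
    rw [← Complex.exp_add, ← mul_add, ← Complex.ofReal_add]
    congr 3
    have : σ * (l * s - l * (x / (2 * τ))) ^ 2 = σ * l ^ 2 * (s - x / (2 * τ)) ^ 2 := by ring
    rw [this, hστ]
    field_simp
    ring
  simp_rw [hpt]
  rw [intervalIntegral.integral_const_mul, norm_mul, norm_cexp_I_mul_ofReal, one_mul,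
    intervalIntegral.integral_comp_mul_sub
      (fun s : ℝ => Complex.exp (Complex.I * ((σ * s ^ 2 : ℝ) : ℂ))) hl0.ne', norm_smul, norm_inv,
      Real.norm_of_nonneg hl0.le, div_eq_inv_mul (4 : ℝ) l]
  exact mul_le_mul_of_nonneg_left (norm_integral_cexp_sq_le hσ _ _) (inv_nonneg.mpr hl0.le)

/-! ### Dispersive decay of oscillatory integrals with a radial amplitude -/

theorem notMem_cube_imp {n : ℕ} {y : Fin n → ℝ}
    (hy : y ∉ Set.Icc (fun _ : Fin n => (-2 : ℝ)) (fun _ => 2)) : 4 < ∑ i, y i ^ 2 := by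
  by_contra! h
  apply hy
  have h1 : ∀ i, y i ^ 2 ≤ 2 ^ 2 := fun i => by
    have := Finset.single_le_sum (f := fun i => y i ^ 2) (fun i _ => sq_nonneg (y i))
      (Finset.mem_univ i)
    linarith
  exact ⟨fun i => (abs_le_of_sq_le_sq' (h1 i) (by norm_num)).1,
    fun i => (abs_le_of_sq_le_sq' (h1 i) (by norm_num)).2⟩

/-- The ball of radius 2 is enclosed in the cube `[-2,2]^n`, whose volume `4^n` is later beaten by
`(2π)^n`. -/
theorem norm_integral_pi_le {n : ℕ} {f : (Fin n → ℝ) → ℂ} {M : ℝ}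
    (hM : ∀ y, ‖f y‖ ≤ M) (h0 : ∀ y, 4 < ∑ i, y i ^ 2 → f y = 0) :
    ‖∫ y, f y‖ ≤ M * 4 ^ n := by
  rw [← setIntegral_eq_integral_of_forall_compl_eq_zero
    (s := Set.Icc (fun _ : Fin n => (-2 : ℝ)) (fun _ => 2)) fun y hy => h0 y (notMem_cube_imp hy)]
  refine (norm_setIntegral_le_of_norm_le_const isCompact_Icc.measure_lt_top
    fun y _ => hM y).trans (le_of_eq ?_)
  rw [Measure.real, Real.volume_Icc_pi]
  simp
  norm_num

/-- Integration by parts against a quadratic phase in one variable. -/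
theorem integral_cexp_quadratic_mul (x τ c : ℝ) {g g' : ℝ → ℝ}
    (hg : ∀ s, HasDerivAt g (g' s) s) (hg' : Continuous g')
    (h0 : ∀ s, 4 ≤ s → g s = 0) (h0' : ∀ s, 4 ≤ s → g' s = 0) (hc : 0 ≤ c) :
    ∫ s : ℝ, Complex.exp (Complex.I * ((x * s - τ * s ^ 2 : ℝ) : ℂ)) * (g (s ^ 2 + c) : ℂ)
      = - ∫ s : ℝ, (∫ r in (0 : ℝ)..s, Complex.exp (Complex.I * ((x * r - τ * r ^ 2 : ℝ) : ℂ)))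
          * ((2 * s * g' (s ^ 2 + c) : ℝ) : ℂ) := by
  have hgc : Continuous g := continuous_iff_continuousAt.mpr fun s => (hg s).continuousAt
  have hEc : Continuous fun r : ℝ => Complex.exp (Complex.I * ((x * r - τ * r ^ 2 : ℝ) : ℂ)) := by
    fun_prop
  have hE : ∀ s : ℝ, HasDerivAt
      (fun s : ℝ => ∫ r in (0 : ℝ)..s, Complex.exp (Complex.I * ((x * r - τ * r ^ 2 : ℝ) : ℂ)))
      (Complex.exp (Complex.I * ((x * s - τ * s ^ 2 : ℝ) : ℂ))) s := fun s =>
    intervalIntegral.integral_hasDerivAt_right (hEc.intervalIntegrable _ _)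
      (hEc.stronglyMeasurableAtFilter _ _) hEc.continuousAt
  have hEcont := continuous_iff_continuousAt.mpr fun s => (hE s).continuousAt
  have hG : ∀ s : ℝ, HasDerivAt (fun s : ℝ => (g (s ^ 2 + c) : ℂ))
      ((2 * s * g' (s ^ 2 + c) : ℝ) : ℂ) s := by
    intro s
    have h1 : HasDerivAt (fun s : ℝ => s ^ 2 + c) (2 * s) s := by
      simpa using (hasDerivAt_pow 2 s).add_const c
    have h2 := ((hg (s ^ 2 + c)).comp s h1).ofReal_comp
    rw [mul_comm (g' _)] at h2
    exact h2
  have hsq : ∀ s ∉ Set.Icc (-2 : ℝ) 2, 4 ≤ s ^ 2 + c := by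
    intro s hs
    by_contra! h
    exact hs (abs_le.mp (abs_le_of_sq_le_sq (by linarith) (by norm_num)))
  have hs1 : HasCompactSupport fun s : ℝ => (g (s ^ 2 + c) : ℂ) :=
    HasCompactSupport.intro (isCompact_Icc (a := (-2 : ℝ)) (b := 2)) fun s hs => by
      simp [h0 _ (hsq s hs)]
  have hs2 : HasCompactSupport fun s : ℝ => ((2 * s * g' (s ^ 2 + c) : ℝ) : ℂ) :=
    HasCompactSupport.intro (isCompact_Icc (a := (-2 : ℝ)) (b := 2)) fun s hs => by
      simp [h0' _ (hsq s hs)]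
  rw [← neg_eq_iff_eq_neg]
  refine (integral_mul_deriv_eq_deriv_mul_of_integrable (fun s _ => hE s) (fun s _ => hG s)
    ?_ ?_ ?_).symm
  · exact Continuous.integrable_of_hasCompactSupport (hEcont.mul (by fun_prop)) hs2.mul_left
  · exact Continuous.integrable_of_hasCompactSupport (hEc.mul (by fun_prop)) hs1.mul_left
  · exact Continuous.integrable_of_hasCompactSupport (hEcont.mul (by fun_prop)) hs1.mul_left

/-- Each of `d` coordinates is integrated by parts once against its Fresnel primitive, bounded by
`4/√T`. The derivative falls on the amplitude and produces `2s G'` with `|2s| ≤ 4`, hence the factor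
`16/√T`; the interval `[-2,2]` contributes one factor 4 of `4^n`. Encoding the amplitude as a
function of `|y|²` keeps its form under this step, and only the `d`-th derivative has to be bounded.
-/
theorem norm_integral_cexp_mul_radial_le {T : ℝ} (hT : 0 < T) (d : ℕ) :
    ∀ {n : ℕ}, d ≤ n → ∀ (x τ : Fin n → ℝ), (∀ i, |τ i| = T) → ∀ (G : ℕ → ℝ → ℝ),
      (∀ k s, HasDerivAt (G k) (G (k + 1) s) s) → (∀ k s, 4 ≤ s → G k s = 0) →
      ∀ M : ℝ, (∀ s, |G d s| ≤ M) →
      ‖∫ y : Fin n → ℝ, Complex.exp (Complex.I * ((∑ i, (x i * y i - τ i * y i ^ 2) : ℝ) : ℂ))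
        * (G 0 (∑ i, y i ^ 2) : ℂ)‖ ≤ M * 4 ^ n * (16 / √T) ^ d := by
  induction d with
  | zero =>
    intro n _ x τ _ G _ h0 M hM
    rw [pow_zero, mul_one]
    refine norm_integral_pi_le (fun y => ?_) fun y hy => by simp [h0 0 _ hy.le]
    rw [norm_mul, norm_cexp_I_mul_ofReal, one_mul, Complex.norm_real]
    exact hM _
  | succ d ih =>
    intro n hn x τ hτ G hG h0 M hM
    obtain ⟨n, rfl⟩ : ∃ m, n = m + 1 := ⟨n - 1, by omega⟩
    have hGc : ∀ k, Continuous (G k) := fun k =>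
      continuous_iff_continuousAt.mpr fun s => (hG k s).continuousAt
    have hM0 : 0 ≤ M := (abs_nonneg _).trans (hM 0)
    set e1 : ℝ → ℂ := fun s => Complex.exp (Complex.I * ((x 0 * s - τ 0 * s ^ 2 : ℝ) : ℂ)) with he1
    set e2 : (Fin n → ℝ) → ℂ := fun y =>
      Complex.exp (Complex.I * ((∑ i, (x i.succ * y i - τ i.succ * y i ^ 2) : ℝ) : ℂ)) with he2
    set E : ℝ → ℂ := fun s => ∫ r in (0 : ℝ)..s, e1 r with hE
    have he1c : Continuous e1 := by
      simp only [he1]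
      fun_prop
    have he2c : Continuous e2 := by
      simp only [he2]
      fun_prop
    have hEc : Continuous E := intervalIntegral.continuous_primitive
      (fun a b => he1c.intervalIntegrable a b) 0
    have hEb : ∀ s, ‖E s‖ ≤ 4 / √T := by
      intro s
      have hτ0 : τ 0 ≠ 0 := by
        intro h
        have := hτ 0
        rw [h, abs_zero] at this
        exact hT.ne this
      rw [← hτ 0]
      exact norm_integral_cexp_quadratic_le (x 0) hτ0 0 s
    have hcs : ∀ {f : ℝ × (Fin n → ℝ) → ℂ}, Continuous f →
        (∀ z, 4 < z.1 ^ 2 + ∑ i, z.2 i ^ 2 → f z = 0) → Integrable f := by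
      intro f hf hf0
      refine hf.integrable_of_hasCompactSupport (HasCompactSupport.intro
        ((isCompact_Icc (a := (-2 : ℝ)) (b := 2)).prod
          (isCompact_Icc (a := fun _ : Fin n => (-2 : ℝ)) (b := fun _ => 2))) fun z hz => ?_)
      apply hf0
      by_contra! h
      apply hz
      have hnn : 0 ≤ ∑ i, z.2 i ^ 2 := Finset.sum_nonneg fun i _ => sq_nonneg _
      refine ⟨abs_le.mp (abs_le_of_sq_le_sq (by linarith) (by norm_num)), ?_⟩
      by_contra h2
      linarith [notMem_cube_imp h2, sq_nonneg z.1]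
    set F : ℝ × (Fin n → ℝ) → ℂ := fun z =>
      e1 z.1 * e2 z.2 * (G 0 (z.1 ^ 2 + ∑ i, z.2 i ^ 2) : ℂ) with hF
    set F2 : ℝ × (Fin n → ℝ) → ℂ := fun z =>
      -(E z.1 * ((2 * z.1 * G 1 (z.1 ^ 2 + ∑ i, z.2 i ^ 2) : ℝ) : ℂ) * e2 z.2) with hF2
    have hFi : Integrable F := hcs (by fun_prop) fun z hz => by simp [hF, h0 0 _ hz.le]
    have hF2i : Integrable F2 := hcs (by fun_prop) fun z hz => by simp [hF2, h0 1 _ hz.le]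
    have hstep1 : ∫ y : Fin (n + 1) → ℝ,
        Complex.exp (Complex.I * ((∑ i, (x i * y i - τ i * y i ^ 2) : ℝ) : ℂ))
          * (G 0 (∑ i, y i ^ 2) : ℂ) = ∫ z, F z := by
      rw [← (volume_preserving_piFinSuccAbove (fun _ : Fin (n + 1) => ℝ) 0).symm.integral_comp']
      refine integral_congr_ae (Filter.Eventually.of_forall fun z => ?_)
      simp only [hF, he1, he2, Fin.sum_univ_succ, MeasurableEquiv.piFinSuccAbove_symm_apply,
        Fin.insertNthEquiv_zero, Fin.consEquiv_apply, Fin.cons_zero, Fin.cons_succ]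
      rw [← Complex.exp_add, ← mul_add, ← Complex.ofReal_add]
    have hstep2 : ∫ z, F z = ∫ z, F2 z := by
      rw [Measure.volume_eq_prod] at hFi hF2i ⊢
      rw [integral_prod_symm _ hFi, integral_prod_symm _ hF2i]
      refine integral_congr_ae (Filter.Eventually.of_forall fun y => ?_)
      have hnn : 0 ≤ ∑ i, y i ^ 2 := Finset.sum_nonneg fun i _ => sq_nonneg _
      have key := integral_cexp_quadratic_mul (x 0) (τ 0) (∑ i, y i ^ 2) (hG 0) (hGc 1)
        (h0 0) (h0 1) hnn
      simp only [hF, hF2]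
      rw [integral_neg, integral_mul_const, ← neg_mul, ← key, ← integral_mul_const]
      refine integral_congr_ae (Filter.Eventually.of_forall fun s => ?_)
      simp only [he1]
      ring
    rw [hstep1, hstep2]
    rw [Measure.volume_eq_prod] at hF2i ⊢
    rw [integral_prod _ hF2i]
    have hinner : ∀ s, ‖∫ y, F2 (s, y)‖
        ≤ 4 * (4 / √T) * (M * 4 ^ n * (16 / √T) ^ d) := by
      intro s
      have hrhs : 0 ≤ M * 4 ^ n * (16 / √T) ^ d := by positivity
      by_cases hs : |s| ≤ 2
      · have h1 := ih (by omega) (fun i => x i.succ) (fun i => τ i.succ) (fun i => hτ _)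
          (fun k u => G (k + 1) (s ^ 2 + u))
          (fun k u => by simpa using (hG (k + 1) (s ^ 2 + u)).comp_const_add (s ^ 2) u)
          (fun k u hu => h0 _ _ (by nlinarith [sq_nonneg s])) M (fun u => hM _)
        have h2 : ∫ y, F2 (s, y) = -(E s * ((2 * s : ℝ) : ℂ)) *
            ∫ y, e2 y * (G 1 (s ^ 2 + ∑ i, y i ^ 2) : ℂ) := by
          rw [← integral_const_mul]
          refine integral_congr_ae (Filter.Eventually.of_forall fun y => ?_)
          simp only [hF2]
          push_cast
          ring
        rw [h2, norm_mul]
        refine mul_le_mul ?_ h1 (norm_nonneg _) (by positivity)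
        rw [norm_neg, norm_mul, mul_comm, Complex.norm_real, Real.norm_eq_abs, abs_mul]
        refine mul_le_mul ?_ (hEb s) (norm_nonneg _) (by norm_num)
        rw [abs_two]
        linarith
      · have h3 : ∀ y, F2 (s, y) = 0 := by
          intro y
          have hnn : 0 ≤ ∑ i, y i ^ 2 := Finset.sum_nonneg fun i _ => sq_nonneg _
          have h4 : 4 ≤ s ^ 2 + ∑ i, y i ^ 2 := by
            have : 2 < |s| := not_le.mp hs
            nlinarith [sq_abs s]
          simp [hF2, h0 1 _ h4]
        simp only [h3, integral_zero, norm_zero]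
        positivity
    have houter : ∀ s ∉ Set.Icc (-2 : ℝ) 2, ∫ y, F2 (s, y) = 0 := by
      intro s hs
      refine (integral_congr_ae (Filter.Eventually.of_forall fun y => ?_)).trans
        (integral_zero (Fin n → ℝ) ℂ)
      have hnn : 0 ≤ ∑ i, y i ^ 2 := Finset.sum_nonneg fun i _ => sq_nonneg _
      have h4 : 4 ≤ s ^ 2 + ∑ i, y i ^ 2 := by
        by_contra! h
        exact hs (abs_le.mp (abs_le_of_sq_le_sq (by linarith) (by norm_num)))
      simp [hF2, h0 1 _ h4]
    rw [← setIntegral_eq_integral_of_forall_compl_eq_zero houter]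
    refine (norm_setIntegral_le_of_norm_le_const isCompact_Icc.measure_lt_top
      fun s _ => hinner s).trans (le_of_eq ?_)
    rw [Measure.real, Real.volume_Icc, ENNReal.toReal_ofReal (by norm_num)]
    ring

/-! ### Non-stationary phase in a fixed direction -/

theorem norm_integral_eucl_le {n : ℕ} {f : Eucl n → ℂ} {M : ℝ}
    (hM : ∀ ξ, ‖f ξ‖ ≤ M) (h0 : ∀ ξ, 2 < ‖ξ‖ → f ξ = 0) : ‖∫ ξ, f ξ‖ ≤ M * 4 ^ n := by
  rw [← (PiLp.volume_preserving_toLp (Fin n)).integral_comp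
    (MeasurableEquiv.toLp 2 (Fin n → ℝ)).measurableEmbedding]
  refine norm_integral_pi_le (fun y => hM _) fun y hy => h0 _ ?_
  have h1 : ‖(WithLp.toLp 2 y : Eucl n)‖ ^ 2 = ∑ i, y i ^ 2 := by
    rw [EuclideanSpace.real_norm_sq_eq]
  nlinarith [norm_nonneg (WithLp.toLp 2 y : Eucl n)]

/-- Meant for quotients `g / a^k`, whose denominator may vanish outside the support of `g`:
measurability avoids any discussion of continuity there. -/
theorem integrable_of_measurable_of_bounded {n : ℕ} {f : Eucl n → ℂ} {M : ℝ} (hf : Measurable f)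
    (hM : ∀ ξ, ‖f ξ‖ ≤ M) (h0 : ∀ ξ, 2 < ‖ξ‖ → f ξ = 0) : Integrable f := by
  rw [← integrableOn_iff_integrable_of_support_subset (s := Metric.closedBall 0 2)]
  · exact Measure.integrableOn_of_bounded (M := M) measure_closedBall_lt_top.ne
      hf.aestronglyMeasurable (Filter.Eventually.of_forall hM)
  · intro ξ hξ
    by_contra h
    exact hξ (h0 ξ (by simpa using h))

/-- The oscillating factor `exp(i (x·ξ - t |ξ|²_±))`. -/
def osc {n : ℕ} (ε : Fin n → ℝ) (t : ℝ) (x ξ : Eucl n) : ℂ :=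
  Complex.exp (Complex.I * ((inner ℝ x ξ - t * quadForm ε ξ : ℝ) : ℂ))

theorem norm_osc {n : ℕ} (ε : Fin n → ℝ) (t : ℝ) (x ξ : Eucl n) : ‖osc ε t x ξ‖ = 1 :=
  norm_cexp_I_mul_ofReal _

theorem continuous_quadForm {n : ℕ} (ε : Fin n → ℝ) : Continuous (quadForm ε) := by
  unfold quadForm
  fun_prop

theorem continuous_osc {n : ℕ} (ε : Fin n → ℝ) :
    Continuous fun z : (ℝ × Eucl n) × Eucl n => osc ε z.1.1 z.1.2 z.2 := by
  have := continuous_quadForm ε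
  unfold osc
  fun_prop

/-- The bilinear form whose quadratic form is `|ξ|²_±`. -/
def bilForm {n : ℕ} (ε : Fin n → ℝ) (ξ η : Eucl n) : ℝ := ∑ i, ε i * ξ i * η i

theorem continuous_bilForm {n : ℕ} (ε : Fin n → ℝ) (e : Eucl n) :
    Continuous fun ξ => bilForm ε ξ e := by
  unfold bilForm
  fun_prop

theorem quadForm_add_smul {n : ℕ} (ε : Fin n → ℝ) (ξ e : Eucl n) (s : ℝ) :
    quadForm ε (ξ + s • e) = quadForm ε ξ + 2 * s * bilForm ε ξ e + s ^ 2 * quadForm ε e := by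
  simp only [quadForm, bilForm, Finset.mul_sum, ← Finset.sum_add_distrib]
  refine Finset.sum_congr rfl fun i _ => ?_
  simp
  ring

theorem bilForm_add_smul {n : ℕ} (ε : Fin n → ℝ) (ξ e : Eucl n) (s : ℝ) :
    bilForm ε (ξ + s • e) e = bilForm ε ξ e + s * quadForm ε e := by
  simp only [quadForm, bilForm, Finset.mul_sum, ← Finset.sum_add_distrib]
  refine Finset.sum_congr rfl fun i _ => ?_
  simp
  ring

/-- Cauchy–Schwarz, since `|ε i| = 1`. In the non-stationary regime the signs enter only through
this bound. -/
theorem abs_bilForm_le {n : ℕ} {ε : Fin n → ℝ} (hε : ∀ i, ε i = 1 ∨ ε i = -1) (ξ η : Eucl n) :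
    |bilForm ε ξ η| ≤ ‖ξ‖ * ‖η‖ := by
  refine abs_le_of_sq_le_sq ?_ (by positivity)
  have h := Finset.sum_mul_sq_le_sq_mul_sq Finset.univ (fun i => ε i * ξ i) (fun i => η i)
  rw [mul_pow, EuclideanSpace.real_norm_sq_eq, EuclideanSpace.real_norm_sq_eq]
  refine h.trans (le_of_eq ?_)
  congr 1
  refine Finset.sum_congr rfl fun i _ => ?_
  rcases hε i with h | h <;> simp [h]

theorem quadForm_eq_bilForm {n : ℕ} (ε : Fin n → ℝ) (ξ : Eucl n) :
    quadForm ε ξ = bilForm ε ξ ξ :=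
  Finset.sum_congr rfl fun i _ => by ring

/-- The derivative of the phase `x·ξ - t |ξ|²_±` in the direction `e`. -/
def phaseDeriv {n : ℕ} (ε : Fin n → ℝ) (t : ℝ) (x e ξ : Eucl n) : ℝ :=
  inner ℝ x e - 2 * t * bilForm ε ξ e

theorem continuous_phaseDeriv {n : ℕ} (ε : Fin n → ℝ) (t : ℝ) (x e : Eucl n) :
    Continuous (phaseDeriv ε t x e) :=
  continuous_const.sub (continuous_const.mul (continuous_bilForm ε e))

theorem hasLineDerivAt_osc {n : ℕ} (ε : Fin n → ℝ) (t : ℝ) (x e ξ : Eucl n) :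
    HasLineDerivAt ℝ (osc ε t x) (Complex.I * phaseDeriv ε t x e ξ * osc ε t x ξ) ξ e := by
  have h1 : HasDerivAt (fun s : ℝ => inner ℝ x (ξ + s • e) - t * quadForm ε (ξ + s • e))
      (phaseDeriv ε t x e ξ) 0 := by
    have h2 : (fun s : ℝ => inner ℝ x (ξ + s • e) - t * quadForm ε (ξ + s • e)) =
        fun s : ℝ => (inner ℝ x ξ - t * quadForm ε ξ) + s * phaseDeriv ε t x e ξ
          + s ^ 2 * (-t * quadForm ε e) := by
      funext s
      rw [quadForm_add_smul, inner_add_right, inner_smul_right, phaseDeriv]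
      ring
    rw [h2]
    refine ((((hasDerivAt_id (0 : ℝ)).mul_const _).const_add _).add
      ((hasDerivAt_pow 2 (0 : ℝ)).mul_const _)).congr_deriv ?_
    simp
  have h3 := (h1.ofReal_comp.const_mul Complex.I).cexp
  refine HasDerivAt.congr_deriv (f := fun s : ℝ => osc ε t x (ξ + s • e)) h3 ?_
  simp only [zero_smul, add_zero, osc]
  ring

section Amplitude

variable {n : ℕ} {ε : Fin n → ℝ} {t : ℝ} {x e : Eucl n} {ρ : ℝ} {g g' : Eucl n → ℂ}

theorem integrable_osc_mul_div (hρ : 0 < ρ) (ha : ∀ ξ, ‖ξ‖ ≤ 2 → ρ ≤ |phaseDeriv ε t x e ξ|)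
    (hgc : Continuous g) (h0 : ∀ ξ, 2 < ‖ξ‖ → g ξ = 0) (k : ℕ) :
    Integrable fun ξ => osc ε t x ξ * (g ξ / (phaseDeriv ε t x e ξ : ℂ) ^ k) := by
  obtain ⟨M, hM⟩ := (HasCompactSupport.intro (isCompact_closedBall (0 : Eucl n) 2)
    fun ξ hξ => h0 ξ (by simpa using hξ)).exists_bound_of_continuous hgc
  have hM0 : 0 ≤ M := (norm_nonneg _).trans (hM 0)
  have ho : Continuous (osc ε t x) :=
    (continuous_osc ε).comp (by fun_prop : Continuous fun ξ : Eucl n => ((t, x), ξ))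
  have hp := continuous_phaseDeriv ε t x e
  refine integrable_of_measurable_of_bounded (M := M / ρ ^ k) ?_ (fun ξ => ?_) fun ξ hξ => by
    simp [h0 ξ hξ]
  · exact ho.measurable.mul (hgc.measurable.div
      ((Complex.continuous_ofReal.comp hp).measurable.pow_const k))
  · by_cases hξ : ‖ξ‖ ≤ 2
    · rw [norm_mul, norm_osc, one_mul, norm_div, norm_pow, Complex.norm_real, Real.norm_eq_abs]
      gcongr
      · exact hM ξ
      · exact ha ξ hξ
    · rw [h0 ξ (not_le.mp hξ)]
      simp
      positivity

/-- Integration by parts against `osc` in the direction `e`. -/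
theorem integral_osc_mul_div (hρ : 0 < ρ) (ha : ∀ ξ, ‖ξ‖ ≤ 2 → ρ ≤ |phaseDeriv ε t x e ξ|)
    (hgc : Continuous g) (hgc' : Continuous g') (hg : ∀ ξ, HasLineDerivAt ℝ g (g' ξ) ξ e)
    (h0 : ∀ ξ, 2 < ‖ξ‖ → g ξ = 0) (h0' : ∀ ξ, 2 < ‖ξ‖ → g' ξ = 0) (k : ℕ) :
    ∫ ξ, osc ε t x ξ * (g ξ / (phaseDeriv ε t x e ξ : ℂ) ^ k)
      = Complex.I * (∫ ξ, osc ε t x ξ * (g' ξ / (phaseDeriv ε t x e ξ : ℂ) ^ (k + 1)))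
        - Complex.I * ((k + 1) * (-2 * t * quadForm ε e : ℝ)) *
          ∫ ξ, osc ε t x ξ * (g ξ / (phaseDeriv ε t x e ξ : ℂ) ^ (k + 2)) := by
  set a : Eucl n → ℝ := phaseDeriv ε t x e with hadef
  set α : ℝ := -2 * t * quadForm ε e with hα
  have ha0 : ∀ ξ, ‖ξ‖ ≤ 2 → (a ξ : ℂ) ≠ 0 := fun ξ hξ => by
    have := abs_pos.mp (hρ.trans_le (ha ξ hξ))
    exact_mod_cast this
  -- The phase is quadratic, so its derivative is affine along `e` with constant slope `α`; no
  -- higher derivatives of the phase appear.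
  have hasum : ∀ ξ (s : ℝ), a (ξ + s • e) = a ξ + s * α := by
    intro ξ s
    simp only [hadef, phaseDeriv, bilForm_add_smul, hα]
    ring
  have hder : ∀ ξ, HasLineDerivAt ℝ (fun ξ => g ξ / (a ξ : ℂ) ^ (k + 1))
      (g' ξ / (a ξ : ℂ) ^ (k + 1) - (k + 1) * α * (g ξ / (a ξ : ℂ) ^ (k + 2))) ξ e := by
    intro ξ
    by_cases hξ : ‖ξ‖ ≤ 2
    · have h1 : HasDerivAt (fun s : ℝ => ((a (ξ + s • e) : ℝ) : ℂ)) (α : ℂ) 0 := by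
        simp_rw [hasum]
        exact ((((hasDerivAt_id (0 : ℝ)).mul_const α).const_add (a ξ)).congr_deriv
          (one_mul α)).ofReal_comp
      have h2 := (hg ξ).fun_div (h1.fun_pow (k + 1)) (by simpa using pow_ne_zero (k + 1) (ha0 ξ hξ))
      refine h2.congr_deriv ?_
      have := ha0 ξ hξ
      simp only [zero_smul, add_zero]
      push_cast
      field_simp
      ring
    -- Outside the closed ball `g` vanishes on a neighbourhood, so the quotient is locally zero even
    -- where `a` vanishes, division by zero being zero.
    · have hξ' := not_le.mp hξ
      have h3 : HasDerivAt (fun _ : ℝ => (0 : ℂ)) 0 (0 : ℝ) := hasDerivAt_const _ _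
      have hcont : Continuous fun s : ℝ => ‖ξ + s • e‖ := by fun_prop
      have h4 : ∀ᶠ s in nhds (0 : ℝ), 2 < ‖ξ + s • e‖ :=
        hcont.continuousAt.eventually (lt_mem_nhds (by simpa using hξ'))
      rw [h0 ξ hξ', h0' ξ hξ']
      simp only [zero_div, mul_zero, sub_zero]
      refine h3.congr_of_eventuallyEq ?_
      filter_upwards [h4] with s hs
      simp [h0 _ hs]
  have i1 := integrable_osc_mul_div hρ ha hgc h0 k
  have i2 := integrable_osc_mul_div hρ ha hgc' h0' (k + 1)
  have i3 := integrable_osc_mul_div hρ ha hgc h0 (k + 2)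
  have i4 := integrable_osc_mul_div hρ ha hgc h0 (k + 1)
  have hmul : ∀ ξ, Complex.I * (a ξ : ℂ) * osc ε t x ξ * (g ξ / (a ξ : ℂ) ^ (k + 1))
      = Complex.I * (osc ε t x ξ * (g ξ / (a ξ : ℂ) ^ k)) := by
    intro ξ
    by_cases hξ : ‖ξ‖ ≤ 2
    · have := ha0 ξ hξ
      field_simp
      ring
    · simp [h0 ξ (not_le.mp hξ)]
  have hparts := integral_bilinear_hasLineDerivAt_right_eq_neg_left_of_integrable
    (μ := (volume : Measure (Eucl n)))
    (f := osc ε t x) (f' := fun ξ => Complex.I * (a ξ : ℂ) * osc ε t x ξ)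
    (g := fun ξ => g ξ / (a ξ : ℂ) ^ (k + 1))
    (g' := fun ξ => g' ξ / (a ξ : ℂ) ^ (k + 1) - (k + 1) * α * (g ξ / (a ξ : ℂ) ^ (k + 2)))
    (v := e) (B := ContinuousLinearMap.mul ℝ ℂ)
    (by
      simp only [ContinuousLinearMap.mul_apply', hmul]
      exact i1.const_mul _)
    (by
      simp only [ContinuousLinearMap.mul_apply', mul_sub]
      refine i2.sub ((i3.const_mul ((k + 1) * α)).congr (Filter.Eventually.of_forall fun ξ => ?_))
      simp only
      ring)
    (by
      simp only [ContinuousLinearMap.mul_apply']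
      exact i4)
    (fun ξ _ => hasLineDerivAt_osc ε t x e ξ) (fun ξ _ => hder ξ)
  simp only [ContinuousLinearMap.mul_apply', hmul] at hparts
  rw [integral_const_mul] at hparts
  have hsplit : ∫ ξ, osc ε t x ξ *
      (g' ξ / (a ξ : ℂ) ^ (k + 1) - (k + 1) * α * (g ξ / (a ξ : ℂ) ^ (k + 2)))
      = (∫ ξ, osc ε t x ξ * (g' ξ / (a ξ : ℂ) ^ (k + 1)))
        - (k + 1) * α * ∫ ξ, osc ε t x ξ * (g ξ / (a ξ : ℂ) ^ (k + 2)) := by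
    rw [← integral_const_mul, ← integral_sub i2 (i3.const_mul _)]
    refine integral_congr_ae (Filter.Eventually.of_forall fun ξ => ?_)
    simp only
    ring
  rw [hsplit] at hparts
  have := congrArg (fun z => Complex.I * z) hparts
  simp only [mul_neg, ← mul_assoc, Complex.I_mul_I] at this
  rw [neg_mul, one_mul, neg_neg] at this
  rw [← this]
  ring

theorem norm_integral_osc_mul_div_le (hρ : 0 < ρ)
    (ha : ∀ ξ, ‖ξ‖ ≤ 2 → ρ ≤ |phaseDeriv ε t x e ξ|) {M : ℝ}
    (hM : ∀ ξ, ‖ξ‖ ≤ 2 → ‖g ξ‖ ≤ M) (h0 : ∀ ξ, 2 < ‖ξ‖ → g ξ = 0) (k : ℕ) :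
    ‖∫ ξ, osc ε t x ξ * (g ξ / (phaseDeriv ε t x e ξ : ℂ) ^ k)‖ ≤ M / ρ ^ k * 4 ^ n := by
  have hM0 : 0 ≤ M := (norm_nonneg _).trans (hM 0 (by simp))
  refine norm_integral_eucl_le (fun ξ => ?_) fun ξ hξ => by simp [h0 ξ hξ]
  by_cases hξ : ‖ξ‖ ≤ 2
  · rw [norm_mul, norm_osc, one_mul, norm_div, norm_pow, Complex.norm_real, Real.norm_eq_abs]
    gcongr
    · exact hM ξ hξ
    · exact ha ξ hξ
  · rw [h0 ξ (not_le.mp hξ)]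
    simp
    positivity

end Amplitude

theorem hasDerivAt_norm_sq_line {n : ℕ} (ξ e : Eucl n) :
    HasDerivAt (fun s : ℝ => ‖ξ + s • e‖ ^ 2) (2 * inner ℝ ξ e) 0 := by
  have h : (fun s : ℝ => ‖ξ + s • e‖ ^ 2)
      = fun s : ℝ => ‖ξ‖ ^ 2 + s * (2 * inner ℝ ξ e) + s ^ 2 * ‖e‖ ^ 2 := by
    funext s
    rw [norm_add_sq_real, inner_smul_right, norm_smul, mul_pow, Real.norm_eq_abs, sq_abs]
    ring
  rw [h]
  refine ((((hasDerivAt_id (0 : ℝ)).mul_const _).const_add _).add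
    ((hasDerivAt_pow 2 (0 : ℝ)).mul_const _)).congr_deriv ?_
  simp

/-- On the support the phase derivative is at least `ρ = |r|/2` and its slope satisfies `|α| ≤
|r|/4`. Hence every `α` produced by integration by parts is paid for by an additional factor `1/a`,
and two rounds gain `r⁻²`. -/
theorem norm_integral_osc_mul_radial_le_of_nonstationary {n : ℕ} {ε : Fin n → ℝ}
    (hε : ∀ i, ε i = 1 ∨ ε i = -1) {t : ℝ} {x e : Eucl n} (he : ‖e‖ = 1)
    (hr : 0 < |inner ℝ x e|) (ht : 8 * |t| ≤ |inner ℝ x e|) {G : ℕ → ℝ → ℝ}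
    (hG : ∀ k s, HasDerivAt (G k) (G (k + 1) s) s) (h0 : ∀ k s, 4 ≤ s → G k s = 0)
    {M : ℝ} (hM : ∀ k ≤ 2, ∀ s, |G k s| ≤ M) :
    ‖∫ ξ : Eucl n, osc ε t x ξ * (G 0 (‖ξ‖ ^ 2) : ℂ)‖
      ≤ 99 * M * 4 ^ n / inner ℝ x e ^ 2 := by
  set r : ℝ := inner ℝ x e with hrdef
  have hGc : ∀ k, Continuous (G k) := fun k =>
    continuous_iff_continuousAt.mpr fun s => (hG k s).continuousAt
  have hM0 : 0 ≤ M := (abs_nonneg _).trans (hM 0 (by norm_num) 0)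
  set ρ : ℝ := |r| / 2 with hρdef
  have hρ : 0 < ρ := by positivity
  have ha : ∀ ξ, ‖ξ‖ ≤ 2 → ρ ≤ |phaseDeriv ε t x e ξ| := by
    intro ξ hξ
    have h1 : |2 * t * bilForm ε ξ e| ≤ |r| / 2 := by
      rw [abs_mul, abs_mul, abs_two]
      have := abs_bilForm_le hε ξ e
      rw [he, mul_one] at this
      nlinarith [abs_nonneg t, abs_nonneg (bilForm ε ξ e)]
    have h2 := abs_sub_abs_le_abs_sub r (2 * t * bilForm ε ξ e)
    rw [phaseDeriv]
    linarith
  have hα : |-2 * t * quadForm ε e| ≤ |r| / 4 := by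
    rw [abs_mul, abs_mul, abs_neg, abs_two]
    have := abs_bilForm_le hε e e
    rw [he, mul_one, ← quadForm_eq_bilForm] at this
    nlinarith [abs_nonneg t, abs_nonneg (quadForm ε e)]
  set α : ℝ := -2 * t * quadForm ε e with hαdef
  set g : Eucl n → ℂ := fun ξ => (G 0 (‖ξ‖ ^ 2) : ℂ) with hg
  set g1 : Eucl n → ℂ := fun ξ => ((2 * inner ℝ ξ e * G 1 (‖ξ‖ ^ 2) : ℝ) : ℂ) with hg1
  set g2 : Eucl n → ℂ := fun ξ =>
    ((2 * G 1 (‖ξ‖ ^ 2) + 4 * inner ℝ ξ e ^ 2 * G 2 (‖ξ‖ ^ 2) : ℝ) : ℂ) with hg2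
  have gc : Continuous g := by fun_prop
  have gc1 : Continuous g1 := by fun_prop
  have gc2 : Continuous g2 := by fun_prop
  have hsq : ∀ ξ : Eucl n, 2 < ‖ξ‖ → 4 ≤ ‖ξ‖ ^ 2 := fun ξ hξ => by nlinarith
  have g0 : ∀ ξ, 2 < ‖ξ‖ → g ξ = 0 := fun ξ hξ => by simp [hg, h0 0 _ (hsq ξ hξ)]
  have g10 : ∀ ξ, 2 < ‖ξ‖ → g1 ξ = 0 := fun ξ hξ => by simp [hg1, h0 1 _ (hsq ξ hξ)]
  have g20 : ∀ ξ, 2 < ‖ξ‖ → g2 ξ = 0 := fun ξ hξ => by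
    simp [hg2, h0 1 _ (hsq ξ hξ), h0 2 _ (hsq ξ hξ)]
  have hGl : ∀ k (ξ : Eucl n), HasDerivAt (fun s : ℝ => G k (‖ξ + s • e‖ ^ 2))
      (2 * inner ℝ ξ e * G (k + 1) (‖ξ‖ ^ 2)) 0 := by
    intro k ξ
    have h1 : HasDerivAt (G k) (G (k + 1) (‖ξ‖ ^ 2)) (‖ξ + (0 : ℝ) • e‖ ^ 2) := by
      rw [zero_smul, add_zero]
      exact hG k _
    refine (h1.comp (0 : ℝ) (hasDerivAt_norm_sq_line ξ e)).congr_deriv ?_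
    ring
  have d1 : ∀ ξ, HasLineDerivAt ℝ g (g1 ξ) ξ e := fun ξ => (hGl 0 ξ).ofReal_comp
  have d2 : ∀ ξ, HasLineDerivAt ℝ g1 (g2 ξ) ξ e := by
    intro ξ
    have h1 : HasDerivAt (fun s : ℝ => 2 * inner ℝ (ξ + s • e) e) 2 (0 : ℝ) := by
      have h2 : (fun s : ℝ => 2 * inner ℝ (ξ + s • e) e)
          = fun s : ℝ => 2 * inner ℝ ξ e + s * 2 := by
        funext s
        rw [inner_add_left, real_inner_smul_left, real_inner_self_eq_norm_sq, he]
        ring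
      rw [h2]
      simpa using ((hasDerivAt_id (0 : ℝ)).mul_const 2).const_add (2 * inner ℝ ξ e)
    refine HasDerivAt.congr_deriv (h1.mul (hGl 1 ξ)).ofReal_comp ?_
    simp only [zero_smul, add_zero, hg2]
    congr 1
    ring
  have hin : ∀ ξ : Eucl n, ‖ξ‖ ≤ 2 → |inner ℝ ξ e| ≤ 2 := fun ξ hξ => by
    have := abs_real_inner_le_norm ξ e
    rw [he, mul_one] at this
    linarith
  have b0 : ∀ ξ, ‖ξ‖ ≤ 2 → ‖g ξ‖ ≤ M := fun ξ _ => by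
    simp only [hg]
    rw [Complex.norm_real]
    exact hM 0 (by norm_num) _
  have b1 : ∀ ξ, ‖ξ‖ ≤ 2 → ‖g1 ξ‖ ≤ 4 * M := fun ξ hξ => by
    simp only [hg1]
    rw [Complex.norm_real, Real.norm_eq_abs, abs_mul, abs_mul, abs_two]
    have := hM 1 (by norm_num) (‖ξ‖ ^ 2)
    have h3 := hin ξ hξ
    refine mul_le_mul (by linarith) this (abs_nonneg _) (by norm_num)
  have b2 : ∀ ξ, ‖ξ‖ ≤ 2 → ‖g2 ξ‖ ≤ 18 * M := fun ξ hξ => by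
    simp only [hg2]
    rw [Complex.norm_real, Real.norm_eq_abs]
    refine (abs_add_le _ _).trans ?_
    rw [abs_mul, abs_mul, abs_mul, abs_two, abs_of_pos (by norm_num : (0 : ℝ) < 4), abs_pow]
    have h1 := hM 1 (by norm_num) (‖ξ‖ ^ 2)
    have h2 := hM 2 (by norm_num) (‖ξ‖ ^ 2)
    have h3 : |inner ℝ ξ e| ^ 2 ≤ 4 := by nlinarith [hin ξ hξ, abs_nonneg (inner ℝ ξ e)]
    have h4 : 4 * |inner ℝ ξ e| ^ 2 * |G 2 (‖ξ‖ ^ 2)| ≤ 16 * M :=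
      mul_le_mul (by linarith) h2 (abs_nonneg _) (by norm_num)
    linarith
  have p1 := integral_osc_mul_div hρ ha gc gc1 d1 g0 g10 0
  have p2 := integral_osc_mul_div hρ ha gc1 gc2 d2 g10 g20 1
  have p3 := integral_osc_mul_div hρ ha gc gc1 d1 g0 g10 2
  have n1 := norm_integral_osc_mul_div_le hρ ha b2 g20 2
  have n2 := norm_integral_osc_mul_div_le hρ ha b1 g10 3
  have n3 := norm_integral_osc_mul_div_le hρ ha b0 g0 4
  simp only [pow_zero, div_one, Nat.cast_zero, Nat.cast_one, Nat.cast_ofNat, zero_add, one_mul,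
    show 1 + 1 = 2 from rfl, show 1 + 2 = 3 from rfl,
    show 2 + 2 = 4 from rfl] at p1 p2 p3
  rw [← hαdef] at p1 p2 p3
  set J1 := ∫ ξ, osc ε t x ξ * (g2 ξ / (phaseDeriv ε t x e ξ : ℂ) ^ 2)
  set J2 := ∫ ξ, osc ε t x ξ * (g1 ξ / (phaseDeriv ε t x e ξ : ℂ) ^ 3)
  set J3 := ∫ ξ, osc ε t x ξ * (g ξ / (phaseDeriv ε t x e ξ : ℂ) ^ 4)
  -- The first round leaves one term with `g1` over `a` and one with `g` over `a²`; integrating both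
  -- by parts again and using `I² = -1` gives these three integrals.
  have hfin : ∫ ξ : Eucl n, osc ε t x ξ * (G 0 (‖ξ‖ ^ 2) : ℂ)
      = -J1 + 3 * (α : ℂ) * J2 - 3 * (α : ℂ) ^ 2 * J3 := by
    rw [p1, p2, p3]
    ring_nf
    simp only [Complex.I_sq]
    ring
  rw [hfin]
  have hr2 : r ^ 2 = |r| ^ 2 := (sq_abs r).symm
  have hα3 : ‖3 * (α : ℂ)‖ ≤ 3 * (|r| / 4) := by
    rw [norm_mul, Complex.norm_real, Real.norm_eq_abs]
    simpa using hα
  have hα4 : ‖3 * (α : ℂ) ^ 2‖ ≤ 3 * (|r| / 4) ^ 2 := by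
    rw [norm_mul, norm_pow, Complex.norm_real, Real.norm_eq_abs]
    simpa using pow_le_pow_left₀ (abs_nonneg _) hα 2
  calc ‖-J1 + 3 * (α : ℂ) * J2 - 3 * (α : ℂ) ^ 2 * J3‖
      ≤ ‖J1‖ + ‖3 * (α : ℂ)‖ * ‖J2‖ + ‖3 * (α : ℂ) ^ 2‖ * ‖J3‖ := by
        rw [← norm_mul, ← norm_mul, ← norm_neg J1]
        exact (norm_sub_le _ _).trans (add_le_add (norm_add_le _ _) le_rfl)
    _ ≤ 18 * M / ρ ^ 2 * 4 ^ n + 3 * (|r| / 4) * (4 * M / ρ ^ 3 * 4 ^ n)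
        + 3 * (|r| / 4) ^ 2 * (M / ρ ^ 4 * 4 ^ n) := by gcongr
    -- With `ρ = |r|/2` the three terms contribute `72 + 24 + 3 = 99`.
    _ = 99 * M * 4 ^ n / r ^ 2 := by
        rw [hr2, hρdef]
        field_simp
        ring

/-! ### Decay of the kernel of a frequency-localized propagator -/

/-- The profile of `ψ(ξ)²` as a function of `|ξ|²`. -/
def profile (χ : Cutoff) (s : ℝ) : ℝ := (χ.toFun √s - χ.toFun (2 * √s)) ^ 2

theorem Cutoff.eq_zero (χ : Cutoff) {s : ℝ} (hs : 2 ≤ s) : χ.toFun s = 0 := by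
  by_contra h
  have := (χ.tsupport_subset (subset_tsupport _ h)).2
  linarith

theorem profile_eq_zero_of_le (χ : Cutoff) {s : ℝ} (hs : s ≤ 1 / 4) : profile χ s = 0 := by
  have h1 : √s ≤ 1 / 2 := by
    rw [Real.sqrt_le_left (by norm_num)]
    linarith
  have h0 := Real.sqrt_nonneg s
  rw [profile, χ.eq_one _ (by rw [abs_of_nonneg h0]; linarith),
    χ.eq_one _ (by rw [abs_of_nonneg (by positivity)]; linarith)]
  norm_num

theorem profile_eq_zero_of_ge (χ : Cutoff) {s : ℝ} (hs : 4 ≤ s) : profile χ s = 0 := by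
  have h1 : 2 ≤ √s := Real.le_sqrt_of_sq_le (by linarith)
  rw [profile, χ.eq_zero h1, χ.eq_zero (by linarith)]
  norm_num

/-- The square root is singular only at 0, and the profile vanishes for `s ≤ 1/4`, including
negative `s`, where `√s = 0`. -/
theorem contDiff_profile (χ : Cutoff) : ContDiff ℝ ∞ (profile χ) := by
  rw [contDiff_iff_contDiffAt]
  intro s
  by_cases hs : s < 1 / 4
  · refine (contDiffAt_const (c := (0 : ℝ))).congr_of_eventuallyEq ?_
    filter_upwards [Iio_mem_nhds hs] with u hu
    exact profile_eq_zero_of_le χ hu.le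
  · have hs0 : s ≠ 0 := by
      intro h
      rw [h] at hs
      norm_num at hs
    have h1 : ContDiffAt ℝ ∞ (fun s : ℝ => √s) s := Real.contDiffAt_sqrt hs0
    exact ((χ.smooth.contDiffAt.comp s h1).sub
      (χ.smooth.contDiffAt.comp s (contDiffAt_const.mul h1))).pow 2

theorem hasDerivAt_iteratedDeriv_profile (χ : Cutoff) (k : ℕ) (s : ℝ) :
    HasDerivAt (iteratedDeriv k (profile χ)) (iteratedDeriv (k + 1) (profile χ) s) s := by
  rw [iteratedDeriv_succ]
  refine DifferentiableAt.hasDerivAt ?_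
  exact (contDiff_profile χ).differentiable_iteratedDeriv k
    (by exact_mod_cast ENat.natCast_lt_top k) s

theorem continuous_iteratedDeriv_profile (χ : Cutoff) (k : ℕ) :
    Continuous (iteratedDeriv k (profile χ)) :=
  continuous_iff_continuousAt.mpr fun s => (hasDerivAt_iteratedDeriv_profile χ k s).continuousAt

theorem iteratedDeriv_profile_eq_zero_of_ge (χ : Cutoff) (k : ℕ) {s : ℝ} (hs : 4 ≤ s) :
    iteratedDeriv k (profile χ) s = 0 := by
  have hcl : IsClosed {s : ℝ | iteratedDeriv k (profile χ) s = 0} :=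
    isClosed_eq (continuous_iteratedDeriv_profile χ k) continuous_const
  have hsub : Set.Ioi (4 : ℝ) ⊆ {s : ℝ | iteratedDeriv k (profile χ) s = 0} := by
    intro u hu
    have : profile χ =ᶠ[nhds u] fun _ => 0 := by
      filter_upwards [Ioi_mem_nhds hu] with v hv
      exact profile_eq_zero_of_ge χ (le_of_lt hv)
    have h2 := this.iteratedDeriv_eq k
    simpa [iteratedDeriv_const] using h2
  have := closure_minimal hsub hcl
  rw [closure_Ioi] at this
  exact this hs

theorem iteratedDeriv_profile_eq_zero_of_neg (χ : Cutoff) (k : ℕ) {s : ℝ} (hs : s < 0) :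
    iteratedDeriv k (profile χ) s = 0 := by
  have : profile χ =ᶠ[nhds s] fun _ => 0 := by
    filter_upwards [Iio_mem_nhds hs] with v hv
    exact profile_eq_zero_of_le χ (by linarith [Set.mem_Iio.mp hv])
  simpa [iteratedDeriv_const] using this.iteratedDeriv_eq k

theorem exists_bound_iteratedDeriv_profile (χ : Cutoff) :
    ∃ M : ℝ, ∀ k ≤ 3, ∀ s, |iteratedDeriv k (profile χ) s| ≤ M := by
  have h : ∀ k, ∃ M : ℝ, ∀ s, |iteratedDeriv k (profile χ) s| ≤ M := fun k => by
    have hs : HasCompactSupport (iteratedDeriv k (profile χ)) :=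
      HasCompactSupport.intro (isCompact_Icc (a := (0 : ℝ)) (b := 4)) fun s hs => by
        rcases lt_or_ge s 0 with h | h
        · exact iteratedDeriv_profile_eq_zero_of_neg χ k h
        · refine iteratedDeriv_profile_eq_zero_of_ge χ k ?_
          by_contra h4
          exact hs ⟨h, (not_le.mp h4).le⟩
    exact hs.exists_bound_of_continuous (continuous_iteratedDeriv_profile χ k)
  choose M hM using h
  refine ⟨∑ k ∈ Finset.range 4, |M k|, fun k hk s => (hM k s).trans ((le_abs_self _).trans ?_)⟩
  exact Finset.single_le_sum (f := fun k => |M k|) (fun _ _ => abs_nonneg _)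
    (Finset.mem_range.mpr (by omega))

/-- In coordinates the phase splits into one-variable quadratics with coefficients `t ε i`, all of
modulus `|t|`. -/
theorem norm_integral_osc_mul_radial_le {n d : ℕ} (hd : d ≤ n) {ε : Fin n → ℝ}
    (hε : ∀ i, ε i = 1 ∨ ε i = -1) {t : ℝ} (ht : t ≠ 0) (x : Eucl n) {G : ℕ → ℝ → ℝ}
    (hG : ∀ k s, HasDerivAt (G k) (G (k + 1) s) s) (h0 : ∀ k s, 4 ≤ s → G k s = 0)
    {M : ℝ} (hM : ∀ s, |G d s| ≤ M) :
    ‖∫ ξ : Eucl n, osc ε t x ξ * (G 0 (‖ξ‖ ^ 2) : ℂ)‖ ≤ M * 4 ^ n * (16 / √|t|) ^ d := by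
  have h := norm_integral_cexp_mul_radial_le (abs_pos.mpr ht) d hd (fun i => x i)
    (fun i => t * ε i) (fun i => by rcases hε i with h | h <;> simp [h]) G hG h0 M hM
  rw [← (PiLp.volume_preserving_toLp (Fin n)).integral_comp
    (MeasurableEquiv.toLp 2 (Fin n → ℝ)).measurableEmbedding]
  refine le_of_eq_of_le ?_ h
  congr 1
  refine integral_congr_ae (Filter.Eventually.of_forall fun y => ?_)
  simp only [EuclideanSpace.real_norm_sq_eq, osc, quadForm]
  congr 4
  rw [PiLp.inner_apply, Finset.mul_sum, ← Finset.sum_sub_distrib]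
  refine Finset.sum_congr rfl fun i _ => ?_
  simp
  ring

/-- The kernel of the localized propagator at unit frequency decays like `|x·e|^{-d/2}`, uniformly
in time and in the dimension. -/
theorem exists_norm_integral_osc_mul_profile_le (χ : Cutoff) :
    ∃ A : ℝ, 0 ≤ A ∧ ∀ (n d : ℕ), d ≤ n → d ≤ 3 → ∀ ε : Fin n → ℝ, (∀ i, ε i = 1 ∨ ε i = -1) →
      ∀ e : Eucl n, ‖e‖ = 1 → ∀ (t : ℝ) (x : Eucl n),
      ‖∫ ξ : Eucl n, osc ε t x ξ * (profile χ (‖ξ‖ ^ 2) : ℂ)‖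
        ≤ A * 4 ^ n * (√(1 + |inner ℝ x e|))⁻¹ ^ d := by
  obtain ⟨M, hM⟩ := exists_bound_iteratedDeriv_profile χ
  have hM0 : 0 ≤ M := (abs_nonneg _).trans (hM 0 (by norm_num) 0)
  -- In the dispersive regime `16/√|t| ≤ 64/√(1+r)`, raised to a power `d ≤ 3`. The same constant
  -- covers the factor 4 for `r ≤ 1` and `99 · 4 = 396` in the non-stationary regime.
  refine ⟨64 ^ 3 * M, by positivity, fun n d hdn hd3 ε hε e he t x => ?_⟩
  have hG := hasDerivAt_iteratedDeriv_profile χ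
  have h0 : ∀ k s, 4 ≤ s → iteratedDeriv k (profile χ) s = 0 := fun k s hs =>
    iteratedDeriv_profile_eq_zero_of_ge χ k hs
  set r : ℝ := |inner ℝ x e| with hr
  have hr0 : 0 ≤ r := abs_nonneg _
  have hsq1 : 1 ≤ √(1 + r) := Real.one_le_sqrt.mpr (by linarith)
  have hsq : √(1 + r) ^ 2 = 1 + r := Real.sq_sqrt (by linarith)
  have hq1 : (√(1 + r))⁻¹ ≤ 1 := inv_le_one_of_one_le₀ hsq1
  have hq0 : 0 < (√(1 + r))⁻¹ := by positivity
  have key : ∀ {X c : ℝ}, X ≤ c * M * 4 ^ n → c ≤ 64 ^ 3 * (√(1 + r))⁻¹ ^ d →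
      X ≤ 64 ^ 3 * M * 4 ^ n * (√(1 + r))⁻¹ ^ d := by
    intro X c h1 h2
    refine h1.trans ?_
    have h3 : 0 ≤ M * 4 ^ n := by positivity
    nlinarith [mul_le_mul_of_nonneg_right h2 h3]
  rcases le_or_gt r 1 with h1 | h1
  · have hq : (1 : ℝ) / 4 ≤ (√(1 + r))⁻¹ ^ d := by
      have h2 : (1 : ℝ) / 4 ≤ (√(1 + r))⁻¹ ^ 4 := by
        rw [inv_pow, show √(1 + r) ^ 4 = (√(1 + r) ^ 2) ^ 2 by ring, hsq, one_div]
        exact inv_anti₀ (by positivity) (by nlinarith)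
      exact h2.trans (pow_le_pow_of_le_one hq0.le hq1 (by omega))
    refine key (c := 1) ?_ (by linarith)
    rw [one_mul]
    refine norm_integral_eucl_le (fun ξ => ?_) fun ξ hξ => ?_
    · rw [norm_mul, norm_osc, one_mul, Complex.norm_real]
      exact hM 0 (by norm_num) _
    · rw [profile_eq_zero_of_ge χ (by nlinarith)]
      simp
  · rcases le_or_gt (8 * |t|) r with h2 | h2
    · have hns := norm_integral_osc_mul_radial_le_of_nonstationary hε he (by linarith) h2 hG h0
        fun k hk => hM k (by omega)
      have hr2 : inner ℝ x e ^ 2 = r ^ 2 := by rw [hr, sq_abs]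
      rw [hr2] at hns
      refine key (c := 99 / r ^ 2) (hns.trans (le_of_eq (by ring))) ?_
      have h3 : (1 : ℝ) / (4 * r ^ 2) ≤ (√(1 + r))⁻¹ ^ 4 := by
        rw [inv_pow, show √(1 + r) ^ 4 = (√(1 + r) ^ 2) ^ 2 by ring, hsq, one_div]
        exact inv_anti₀ (by positivity) (by nlinarith)
      have h4 := h3.trans (pow_le_pow_of_le_one hq0.le hq1 (by omega : d ≤ 4))
      have h5 : 99 / r ^ 2 = 396 * (1 / (4 * r ^ 2)) := by
        field_simp
        norm_num
      rw [h5]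
      nlinarith [pow_pos hq0 d]
    · have ht0 : 0 < |t| := by linarith
      have hdisp := norm_integral_osc_mul_radial_le hdn hε (abs_pos.mp ht0) x hG h0
        (hM d hd3)
      refine key (c := (16 / √|t|) ^ d) (hdisp.trans (le_of_eq (by ring))) ?_
      have h3 : 16 / √|t| ≤ 64 * (√(1 + r))⁻¹ := by
        -- Here `1 + r < 2r < 16|t|`.
        have h4 : √(1 + r) ≤ 4 * √|t| := by
          rw [Real.sqrt_le_left (by positivity), mul_pow, Real.sq_sqrt ht0.le]
          linarith
        have h5 : 0 < √|t| := Real.sqrt_pos.mpr ht0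
        rw [← div_eq_mul_inv, div_le_div_iff₀ h5 (by linarith)]
        linarith
      calc (16 / √|t|) ^ d ≤ (64 * (√(1 + r))⁻¹) ^ d := by gcongr
        _ = 64 ^ d * (√(1 + r))⁻¹ ^ d := mul_pow _ _ _
        _ ≤ 64 ^ 3 * (√(1 + r))⁻¹ ^ d := by
          gcongr
          norm_num

theorem lpSymbol_mul_self_zpow_smul {n : ℕ} (χ : Cutoff) (j : ℤ) (ξ : Eucl n) :
    lpSymbol χ j ((2 : ℝ) ^ j • ξ) * lpSymbol χ j ((2 : ℝ) ^ j • ξ)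
      = (profile χ (‖ξ‖ ^ 2) : ℂ) := by
  have h2 : (2 : ℝ) ^ (-j) * 2 ^ j = 1 := by
    rw [← zpow_add₀ (by norm_num)]
    simp
  rw [lpSymbol, smul_smul, h2, one_smul, profile, Real.sqrt_sq (norm_nonneg _)]
  push_cast
  ring

theorem osc_smul {n : ℕ} (ε : Fin n → ℝ) (t c : ℝ) (x ξ : Eucl n) :
    osc ε t x (c • ξ) = osc ε (c ^ 2 * t) (c • x) ξ := by
  have h : quadForm ε (c • ξ) = c ^ 2 * quadForm ε ξ := by
    simp only [quadForm, Finset.mul_sum]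
    refine Finset.sum_congr rfl fun i _ => ?_
    simp
    ring
  rw [osc, osc, h, inner_smul_right, real_inner_smul_left]
  congr 3
  ring

/-- The kernel of `P_j² W_±(t)`. -/
def propKernel {n : ℕ} (χ : Cutoff) (ε : Fin n → ℝ) (j : ℤ) (t : ℝ) (x : Eucl n) : ℂ :=
  ∫ η : Eucl n, osc ε t x ((2 * Real.pi) • η) *
    (lpSymbol χ j ((2 * Real.pi) • η) * lpSymbol χ j ((2 * Real.pi) • η))

theorem exists_norm_propKernel_le (χ : Cutoff) :
    ∃ A : ℝ, 0 ≤ A ∧ ∀ (n d : ℕ), d ≤ n → d ≤ 3 → ∀ ε : Fin n → ℝ, (∀ i, ε i = 1 ∨ ε i = -1) →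
      ∀ e : Eucl n, ‖e‖ = 1 → ∀ (j : ℤ) (t : ℝ) (x : Eucl n),
      ‖propKernel χ ε j t x‖
        ≤ A * ((2 : ℝ) ^ j) ^ n * (√(1 + 2 ^ j * |inner ℝ x e|))⁻¹ ^ d := by
  obtain ⟨A, hA0, hA⟩ := exists_norm_integral_osc_mul_profile_le χ
  refine ⟨A, hA0, fun n d hdn hd3 ε hε e he j t x => ?_⟩
  set c : ℝ := (2 : ℝ) ^ j with hc
  have hc0 : 0 < c := by positivity
  have hpi := Real.pi_pos
  have h1 : propKernel χ ε j t x = ∫ η : Eucl n,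
      (fun ξ : Eucl n => osc ε (c ^ 2 * t) (c • x) ξ * (profile χ (‖ξ‖ ^ 2) : ℂ))
        ((2 * Real.pi / c) • η) := by
    rw [propKernel]
    refine integral_congr_ae (Filter.Eventually.of_forall fun η => ?_)
    simp only
    rw [← osc_smul, ← lpSymbol_mul_self_zpow_smul χ j, ← hc, smul_smul,
      mul_div_cancel₀ _ hc0.ne']
  rw [h1, Measure.integral_comp_smul volume
    (fun ξ : Eucl n => osc ε (c ^ 2 * t) (c • x) ξ * (profile χ (‖ξ‖ ^ 2) : ℂ)) (2 * Real.pi / c),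
    norm_smul, finrank_euclideanSpace_fin, norm_abs_eq_norm]
  have h2 := hA n d hdn hd3 ε hε e he (c ^ 2 * t) (c • x)
  rw [real_inner_smul_left, abs_mul, abs_of_pos hc0] at h2
  -- The point where the dimension disappears from the constant: `4 ≤ 2π`.
  have h3 : ‖((2 * Real.pi / c) ^ n)⁻¹‖ * 4 ^ n ≤ c ^ n := by
    rw [Real.norm_of_nonneg (by positivity), ← inv_pow, ← mul_pow]
    refine pow_le_pow_left₀ (by positivity) ?_ n
    rw [inv_div, div_mul_eq_mul_div, div_le_iff₀ (by positivity)]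
    nlinarith [Real.pi_gt_three]
  calc _ ≤ ‖((2 * Real.pi / c) ^ n)⁻¹‖ * (A * 4 ^ n * (√(1 + c * |inner ℝ x e|))⁻¹ ^ d) := by gcongr
    _ = A * (‖((2 * Real.pi / c) ^ n)⁻¹‖ * 4 ^ n) * (√(1 + c * |inner ℝ x e|))⁻¹ ^ d := by ring
    _ ≤ _ := by gcongr

/-! ### The `T T*` argument -/

/-- Young's inequality for the bilinear form of a convolution kernel, on the diagonal. -/
theorem lintegral_lintegral_rpow_mul_kernel_le {W k : ℝ → ℝ≥0∞} (hW : Measurable W)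
    (hk : Measurable k) {p : ℝ} (hp : 2 ≤ p) :
    ∫⁻ r, ∫⁻ s, W r ^ (1 - 1 / p) * W s ^ (1 - 1 / p) * k (s - r)
      ≤ (∫⁻ r, W r) ^ (2 - 2 / p) * (∫⁻ r, k r ^ (p / 2)) ^ (2 / p) := by
  have hp0 : 0 < p := by linarith
  have h2p : 0 ≤ 1 - 2 / p := by
    rw [sub_nonneg, div_le_one hp0]
    exact hp
  have h1p : 0 ≤ 1 / p := by positivity
  set A : ℝ × ℝ → ℝ≥0∞ := fun z => W z.1 * W z.2 with hA
  set B : ℝ × ℝ → ℝ≥0∞ := fun z => W z.1 * k (z.2 - z.1) ^ (p / 2) with hB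
  set C : ℝ × ℝ → ℝ≥0∞ := fun z => W z.2 * k (z.2 - z.1) ^ (p / 2) with hC
  have hAm : Measurable A := by fun_prop
  have hkd : Measurable fun z : ℝ × ℝ => k (z.2 - z.1) ^ (p / 2) :=
    (hk.comp (measurable_snd.sub measurable_fst)).pow_const _
  have hBm : Measurable B := (hW.comp measurable_fst).mul hkd
  have hCm : Measurable C := (hW.comp measurable_snd).mul hkd
  -- Splitting for Hölder's inequality with exponents `1 - 2/p`, `1/p`, `1/p`, applied to
  -- `W(r)W(s)`, `W(r)k^{p/2}` and `W(s)k^{p/2}`, whose double integrals all factor.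
  have hpt : ∀ z : ℝ × ℝ, W z.1 ^ (1 - 1 / p) * W z.2 ^ (1 - 1 / p) * k (z.2 - z.1)
      = ∏ i : Fin 3, (![A, B, C] i z) ^ (![1 - 2 / p, 1 / p, 1 / p] i) := by
    intro z
    have e1 : 1 - 1 / p = (1 - 2 / p) + 1 / p := by ring
    have e2 : p / 2 * (1 / p) = 1 / 2 := by field_simp
    have e3 : k (z.2 - z.1) = k (z.2 - z.1) ^ (1 / 2 : ℝ) * k (z.2 - z.1) ^ (1 / 2 : ℝ) := by
      rw [← ENNReal.rpow_add_of_nonneg _ _ (by norm_num) (by norm_num)]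
      norm_num
    rw [Fin.prod_univ_three]
    change _ = (W z.1 * W z.2) ^ (1 - 2 / p) * (W z.1 * k (z.2 - z.1) ^ (p / 2)) ^ (1 / p)
      * (W z.2 * k (z.2 - z.1) ^ (p / 2)) ^ (1 / p)
    rw [ENNReal.mul_rpow_of_nonneg _ _ h2p, ENNReal.mul_rpow_of_nonneg _ _ h1p,
      ENNReal.mul_rpow_of_nonneg _ _ h1p, ← ENNReal.rpow_mul, e2, e1,
      ENNReal.rpow_add_of_nonneg _ _ h2p h1p, ENNReal.rpow_add_of_nonneg _ _ h2p h1p]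
    conv_lhs => rw [e3]
    ring
  have hprod : ∫⁻ r, ∫⁻ s, W r ^ (1 - 1 / p) * W s ^ (1 - 1 / p) * k (s - r)
      = ∫⁻ z : ℝ × ℝ, W z.1 ^ (1 - 1 / p) * W z.2 ^ (1 - 1 / p) * k (z.2 - z.1) := by
    rw [Measure.volume_eq_prod, lintegral_prod]
    exact (((hW.comp measurable_fst).pow_const _).mul ((hW.comp measurable_snd).pow_const _)).mul
      (hk.comp (measurable_snd.sub measurable_fst)) |>.aemeasurable
  have iA : ∫⁻ z, A z = (∫⁻ r, W r) ^ 2 := by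
    rw [Measure.volume_eq_prod, lintegral_prod _ hAm.aemeasurable, sq,
      ← lintegral_mul_const _ hW]
    refine lintegral_congr fun r => ?_
    rw [← lintegral_const_mul _ hW]
  have iB : ∫⁻ z, B z = (∫⁻ r, W r) * ∫⁻ r, k r ^ (p / 2) := by
    rw [Measure.volume_eq_prod, lintegral_prod _ hBm.aemeasurable, ← lintegral_mul_const _ hW]
    refine lintegral_congr fun r => ?_
    rw [← lintegral_sub_right_eq_self (fun s => k s ^ (p / 2)) r,
      ← lintegral_const_mul (W r) (f := fun s => k (s - r) ^ (p / 2))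
        ((hk.comp (measurable_id.sub_const r)).pow_const _)]
  have iC : ∫⁻ z, C z = (∫⁻ r, W r) * ∫⁻ r, k r ^ (p / 2) := by
    rw [Measure.volume_eq_prod, lintegral_prod_symm _ hCm.aemeasurable,
      ← lintegral_mul_const _ hW]
    refine lintegral_congr fun s => ?_
    rw [← lintegral_sub_left_eq_self (fun s => k s ^ (p / 2)) s,
      ← lintegral_const_mul (W s) (f := fun r => k (s - r) ^ (p / 2))
        ((hk.comp (measurable_id.const_sub s)).pow_const _)]
  rw [hprod]
  simp_rw [hpt]
  refine (ENNReal.lintegral_prod_norm_pow_le Finset.univ (fun i _ => ?_) ?_ ?_).trans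
    (le_of_eq ?_)
  · fin_cases i
    exacts [hAm.aemeasurable, hBm.aemeasurable, hCm.aemeasurable]
  · simp [Fin.sum_univ_three]
    ring
  · intro i _
    fin_cases i
    exacts [h2p, h1p, h1p]
  · rw [Fin.prod_univ_three]
    change (∫⁻ z, A z) ^ (1 - 2 / p) * (∫⁻ z, B z) ^ (1 / p) * (∫⁻ z, C z) ^ (1 / p) = _
    rw [iA, iB, iC, ENNReal.mul_rpow_of_nonneg _ _ h1p, ← ENNReal.rpow_natCast, ← ENNReal.rpow_mul]
    have e1 : (2 - 2 / p) = ((2 : ℕ) : ℝ) * (1 - 2 / p) + (1 / p + 1 / p) := by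
      push_cast
      ring
    have e2 : 2 / p = 1 / p + 1 / p := by ring
    rw [e1, ENNReal.rpow_add_of_nonneg _ _ (by positivity) (by positivity),
      ENNReal.rpow_add_of_nonneg _ _ h1p h1p, e2, ENNReal.rpow_add_of_nonneg _ _ h1p h1p]
    ring

section Hilbert

variable {H : Type*} [NormedAddCommGroup H] [InnerProductSpace ℂ H]

/-- Duality with the extremal coefficient: for `F = ⟨κ, f⟩`, `c = |F|^{p-2} F` and `v = ∫ c κ`, the
quantity `A = ∫ |F|^p` equals `⟨f, v⟩`. Expanding `‖v‖²` gives the double integral of `c̄(r) c(s)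
⟨κ(r), κ(s)⟩`, to which Young's inequality applies with `|c| = (|F|^p)^{1-1/p}`. Thus `A ≤ A^{1-1/p}
K^{1/p} ‖f‖`. The set `S` of finite measure makes `A` finite, so that the power of `A` can be
cancelled. -/
theorem setLIntegral_enorm_inner_rpow_le [CompleteSpace H] {κ : ℝ → H}
    (hκ : StronglyMeasurable κ) {B : ℝ}
    (hB : ∀ r, ‖κ r‖ ≤ B) {k : ℝ → ℝ≥0∞} (hk : Measurable k)
    (h : ∀ r s, ‖inner ℂ (κ r) (κ s)‖ₑ ≤ k (r - s)) {p : ℝ} (hp : 2 ≤ p) (f : H)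
    {S : Set ℝ} (hS : MeasurableSet S) (hSfin : volume S < ⊤) :
    ∫⁻ r in S, ‖inner ℂ (κ r) f‖ₑ ^ p ≤ (∫⁻ r, k r ^ (p / 2)) * ‖f‖ₑ ^ p := by
  have hp0 : 0 < p := by linarith
  set K : ℝ≥0∞ := ∫⁻ r, k r ^ (p / 2) with hK
  have hB0 : 0 ≤ B := (norm_nonneg _).trans (hB 0)
  set F : ℝ → ℂ := fun r => inner ℂ (κ r) f with hF
  have hFm : StronglyMeasurable F := hκ.inner stronglyMeasurable_const
  have hFb : ∀ r, ‖F r‖ ≤ B * ‖f‖ := fun r =>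
    (norm_inner_le_norm _ _).trans (mul_le_mul_of_nonneg_right (hB r) (norm_nonneg _))
  set c : ℝ → ℂ := fun r => ((‖F r‖ ^ (p - 2) : ℝ) : ℂ) * F r with hc
  have hcm : StronglyMeasurable c := by
    have h1 : Measurable fun r => ‖F r‖ ^ (p - 2) := hFm.measurable.norm.pow_const _
    exact (Complex.measurable_ofReal.comp h1).stronglyMeasurable.mul hFm
  have hcn : ∀ r, ‖c r‖ = ‖F r‖ ^ (p - 1) := by
    intro r
    rw [hc, norm_mul, Complex.norm_real, Real.norm_of_nonneg (by positivity)]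
    rcases eq_or_ne ‖F r‖ 0 with h0 | h0
    · rw [h0, mul_zero, Real.zero_rpow (by linarith)]
    · rw [← Real.rpow_add_one h0]
      congr 1
      ring
  have hcb : ∀ r, ‖c r‖ ≤ (B * ‖f‖) ^ (p - 1) := fun r => by
    rw [hcn]
    exact Real.rpow_le_rpow (norm_nonneg _) (hFb r) (by linarith)
  have hSfin' : volume S ≠ ⊤ := hSfin.ne
  have hcκ : IntegrableOn (fun r => c r • κ r) S := by
    refine Measure.integrableOn_of_bounded (M := (B * ‖f‖) ^ (p - 1) * B) hSfin'
      (hcm.smul hκ).aestronglyMeasurable (Filter.Eventually.of_forall fun r => ?_)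
    rw [norm_smul]
    exact mul_le_mul (hcb r) (hB r) (norm_nonneg _) (by positivity)
  set v : H := ∫ r in S, c r • κ r with hv
  set A : ℝ≥0∞ := ∫⁻ r in S, ‖F r‖ₑ ^ p with hA
  have hAfin : A ≠ ⊤ := by
    refine (lt_of_le_of_lt (b := ∫⁻ _ in S, (ENNReal.ofReal (B * ‖f‖)) ^ p) ?_ ?_).ne
    · refine lintegral_mono fun r => ?_
      refine ENNReal.rpow_le_rpow ?_ hp0.le
      rw [← ofReal_norm]
      exact ENNReal.ofReal_le_ofReal (hFb r)
    · rw [setLIntegral_const]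
      exact ENNReal.mul_lt_top (ENNReal.rpow_lt_top_of_nonneg hp0.le ENNReal.ofReal_ne_top) hSfin
  have hcF : ∀ r, inner ℂ f (c r • κ r) = ((‖F r‖ ^ p : ℝ) : ℂ) := by
    intro r
    have h1 : inner ℂ f (κ r) = (starRingEnd ℂ) (F r) := (inner_conj_symm _ _).symm
    have h2 : ‖F r‖ ^ p = ‖F r‖ ^ (p - 2) * ‖F r‖ ^ 2 := by
      rcases eq_or_ne ‖F r‖ 0 with h0 | h0
      · rw [h0, Real.zero_rpow hp0.ne']
        norm_num
      · rw [← Real.rpow_natCast, ← Real.rpow_add (lt_of_le_of_ne (norm_nonneg _) h0.symm)]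
        congr 1
        push_cast
        ring
    rw [inner_smul_right, h1, hc, mul_assoc, Complex.mul_conj, h2, Complex.normSq_eq_norm_sq]
    push_cast
    rfl
  have hAv : A ≤ ‖v‖ₑ * ‖f‖ₑ := by
    have h1 : inner ℂ f v = ((∫ r in S, ‖F r‖ ^ p : ℝ) : ℂ) := by
      rw [hv, ← integral_inner hcκ, ← integral_complex_ofReal]
      exact integral_congr_ae (Filter.Eventually.of_forall hcF)
    have h2 : A = ENNReal.ofReal (∫ r in S, ‖F r‖ ^ p) := by
      rw [integral_eq_lintegral_of_nonneg_ae (Filter.Eventually.of_forall fun r => by positivity)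
        (hFm.measurable.norm.pow_const p).aestronglyMeasurable, ENNReal.ofReal_toReal]
      · refine lintegral_congr fun r => ?_
        rw [← ENNReal.ofReal_rpow_of_nonneg (norm_nonneg _) hp0.le, ofReal_norm]
      · convert hAfin using 1
        refine lintegral_congr fun r => ?_
        rw [← ENNReal.ofReal_rpow_of_nonneg (norm_nonneg _) hp0.le, ofReal_norm]
    rw [h2, ← ofReal_norm, ← ofReal_norm, ← ENNReal.ofReal_mul (norm_nonneg _)]
    refine ENNReal.ofReal_le_ofReal ?_
    have h3 := norm_inner_le_norm (𝕜 := ℂ) f v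
    rw [h1, Complex.norm_real] at h3
    rw [mul_comm]
    exact (le_abs_self _).trans h3
  set W : ℝ → ℝ≥0∞ := S.indicator fun r => ‖F r‖ₑ ^ p with hW
  have hWm : Measurable W := (hFm.measurable.enorm.pow_const p).indicator hS
  have hWA : ∫⁻ r, W r = A := lintegral_indicator hS _
  have hcW : ∀ r, S.indicator (fun r => ‖c r‖ₑ) r = W r ^ (1 - 1 / p) := by
    intro r
    by_cases hr : r ∈ S
    · simp only [hW, Set.indicator_of_mem hr]
      rw [← ENNReal.rpow_mul, ← ofReal_norm, hcn,
        ← ENNReal.ofReal_rpow_of_nonneg (norm_nonneg _) (by linarith), ofReal_norm]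
      congr 1
      field_simp
    · simp only [hW, Set.indicator_of_notMem hr]
      rw [ENNReal.zero_rpow_of_pos]
      rw [sub_pos, div_lt_one hp0]
      linarith
  have hv2 : ‖v‖ₑ ^ 2 ≤ A ^ (2 - 2 / p) * K ^ (2 / p) := by
    have h1 : ‖v‖ₑ ^ 2 = ‖inner ℂ v v‖ₑ := by
      rw [inner_self_eq_norm_sq_to_K, ← ofReal_norm, ← ofReal_norm, norm_pow,
        RCLike.norm_ofReal, abs_norm, ENNReal.ofReal_pow (norm_nonneg _)]
    have h2 : ∀ r, ‖inner ℂ v (c r • κ r)‖ₑ ≤ ∫⁻ s in S, ‖c r‖ₑ * ‖c s‖ₑ * k (s - r) := by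
      intro r
      have h3 : ‖inner ℂ v (c r • κ r)‖ₑ = ‖∫ s in S, inner ℂ (c r • κ r) (c s • κ s)‖ₑ := by
        rw [integral_inner hcκ, ← ofReal_norm, ← ofReal_norm, norm_inner_symm]
      rw [h3]
      refine (enorm_integral_le_lintegral_enorm _).trans (lintegral_mono fun s => ?_)
      rw [inner_smul_left, inner_smul_right, enorm_mul, enorm_mul, mul_assoc]
      have h4 : ‖(starRingEnd ℂ) (c r)‖ₑ = ‖c r‖ₑ := by
        rw [← ofReal_norm, RCLike.norm_conj, ofReal_norm]
      have h5 : ‖inner ℂ (κ r) (κ s)‖ₑ ≤ k (s - r) := by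
        rw [← ofReal_norm, norm_inner_symm, ofReal_norm]
        exact h s r
      rw [h4]
      gcongr
    have h6 : ‖inner ℂ v v‖ₑ ≤ ∫⁻ r in S, ∫⁻ s in S, ‖c r‖ₑ * ‖c s‖ₑ * k (s - r) := by
      conv_lhs => rw [hv]
      rw [← hv, ← integral_inner hcκ]
      exact (enorm_integral_le_lintegral_enorm _).trans (lintegral_mono h2)
    rw [h1]
    refine h6.trans ?_
    rw [← hWA]
    refine le_of_eq_of_le ?_ (lintegral_lintegral_rpow_mul_kernel_le hWm hk hp)
    rw [← lintegral_indicator hS]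
    refine lintegral_congr fun r => ?_
    rw [← hcW r]
    by_cases hr : r ∈ S
    · rw [Set.indicator_of_mem hr, Set.indicator_of_mem hr, ← lintegral_indicator hS]
      refine lintegral_congr fun s => ?_
      rw [← hcW s]
      by_cases hs : s ∈ S
      · rw [Set.indicator_of_mem hs, Set.indicator_of_mem hs]
      · rw [Set.indicator_of_notMem hs, Set.indicator_of_notMem hs, mul_zero, zero_mul]
    · rw [Set.indicator_of_notMem hr, Set.indicator_of_notMem hr]
      simp
  have hv1 : ‖v‖ₑ ≤ A ^ (1 - 1 / p) * K ^ (1 / p) := by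
    have h1 := ENNReal.rpow_le_rpow hv2 (by norm_num : (0 : ℝ) ≤ 1 / 2)
    rw [← ENNReal.rpow_natCast, ← ENNReal.rpow_mul, ENNReal.mul_rpow_of_nonneg _ _ (by norm_num),
      ← ENNReal.rpow_mul, ← ENNReal.rpow_mul] at h1
    have e1 : (2 - 2 / p) * (1 / 2) = 1 - 1 / p := by ring
    have e2 : 2 / p * (1 / 2) = 1 / p := by ring
    rw [e1, e2] at h1
    simpa using h1
  rcases eq_or_ne A 0 with hA0 | hA0
  · rw [hA0]
    exact zero_le
  -- Self-improvement: `A` is split so that the common factor `A^{1-1/p}`, neither 0 nor infinite,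
  -- cancels.
  have hmain : A ^ (1 - 1 / p) * A ^ (1 / p) ≤ A ^ (1 - 1 / p) * (K ^ (1 / p) * ‖f‖ₑ) := by
    rw [← ENNReal.rpow_add _ _ hA0 hAfin, sub_add_cancel, ENNReal.rpow_one, ← mul_assoc]
    exact hAv.trans (by gcongr)
  have hA1 : A ^ (1 - 1 / p) ≠ 0 := (ENNReal.rpow_pos hA0.bot_lt hAfin).ne'
  have hA2 : A ^ (1 - 1 / p) ≠ ⊤ := ENNReal.rpow_ne_top_of_ne_zero hA0 hAfin
  have hfin := (ENNReal.mul_le_mul_iff_right hA1 hA2).mp hmain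
  have h1 := ENNReal.rpow_le_rpow hfin hp0.le
  rw [← ENNReal.rpow_mul, ENNReal.mul_rpow_of_nonneg _ _ hp0.le, ← ENNReal.rpow_mul,
    one_div_mul_cancel hp0.ne', ENNReal.rpow_one, ENNReal.rpow_one] at h1
  exact h1

theorem lintegral_enorm_inner_rpow_le [CompleteSpace H] {κ : ℝ → H}
    (hκ : StronglyMeasurable κ) {B : ℝ}
    (hB : ∀ r, ‖κ r‖ ≤ B) {k : ℝ → ℝ≥0∞} (hk : Measurable k)
    (h : ∀ r s, ‖inner ℂ (κ r) (κ s)‖ₑ ≤ k (r - s)) {p : ℝ} (hp : 2 ≤ p) (f : H) :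
    ∫⁻ r, ‖inner ℂ (κ r) f‖ₑ ^ p ≤ (∫⁻ r, k r ^ (p / 2)) * ‖f‖ₑ ^ p := by
  have hmono : Monotone fun N : ℕ => Set.Icc (-(N : ℝ)) N := fun M N hMN =>
    Set.Icc_subset_Icc (neg_le_neg (Nat.cast_le.mpr hMN)) (Nat.cast_le.mpr hMN)
  have hU : ⋃ N : ℕ, Set.Icc (-(N : ℝ)) N = Set.univ := by
    refine Set.eq_univ_of_forall fun x => ?_
    obtain ⟨N, hN⟩ := exists_nat_ge |x|
    exact Set.mem_iUnion.mpr ⟨N, abs_le.mp hN⟩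
  rw [← setLIntegral_univ, ← hU, setLIntegral_iUnion_of_directed _ hmono.directed_le]
  exact iSup_le fun N => setLIntegral_enorm_inner_rpow_le hκ hB hk h hp f measurableSet_Icc
    measure_Icc_lt_top

/-- A measurable selection of the index at which `|⟨κ_i(r), f⟩|` is largest among the first
members of a sequence. -/
theorem exists_stronglyMeasurable_selection {κ : ℕ → ℝ → H} (hκ : ∀ i, StronglyMeasurable (κ i))
    (f : H) (N : ℕ) :
    ∃ σ : ℝ → H, StronglyMeasurable σ ∧ (∀ r, ∃ i, σ r = κ i r) ∧
      ∀ i ≤ N, ∀ r, ‖inner ℂ (κ i r) f‖ₑ ≤ ‖inner ℂ (σ r) f‖ₑ := by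
  classical
  induction N with
  | zero =>
    exact ⟨κ 0, hκ 0, fun r => ⟨0, rfl⟩, fun i hi r => by rw [Nat.le_zero.mp hi]⟩
  | succ N ih =>
    obtain ⟨σ, hσ, hσi, hσN⟩ := ih
    set S : Set ℝ := {r | ‖inner ℂ (σ r) f‖ₑ ≤ ‖inner ℂ (κ (N + 1) r) f‖ₑ} with hS
    have hSm : MeasurableSet S :=
      measurableSet_le (hσ.inner stronglyMeasurable_const).measurable.enorm
        ((hκ _).inner stronglyMeasurable_const).measurable.enorm
    refine ⟨S.piecewise (κ (N + 1)) σ, (hκ _).piecewise hSm hσ, fun r => ?_, fun i hi r => ?_⟩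
    · by_cases hr : r ∈ S
      · exact ⟨N + 1, Set.piecewise_eq_of_mem _ _ _ hr⟩
      · rw [Set.piecewise_eq_of_notMem _ _ _ hr]
        exact hσi r
    · by_cases hr : r ∈ S
      · rw [Set.piecewise_eq_of_mem _ _ _ hr]
        rcases Nat.le_succ_iff.mp hi with h1 | h1
        · exact (hσN i h1 r).trans hr
        · rw [h1]
      · rw [Set.piecewise_eq_of_notMem _ _ _ hr]
        rcases Nat.le_succ_iff.mp hi with h1 | h1
        · exact hσN i h1 r
        · rw [h1]
          exact (not_le.mp hr).le

/-- The maximal form of the `T T*` argument. -/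
theorem lintegral_iSup_enorm_inner_rpow_le [CompleteSpace H] {κ : ℕ → ℝ → H}
    (hκ : ∀ i, StronglyMeasurable (κ i))
    {B : ℝ} (hB : ∀ i r, ‖κ i r‖ ≤ B) {k : ℝ → ℝ≥0∞} (hk : Measurable k)
    (h : ∀ i j r s, ‖inner ℂ (κ i r) (κ j s)‖ₑ ≤ k (r - s)) {p : ℝ} (hp : 2 ≤ p) (f : H) :
    ∫⁻ r, (⨆ i, ‖inner ℂ (κ i r) f‖ₑ) ^ p ≤ (∫⁻ r, k r ^ (p / 2)) * ‖f‖ₑ ^ p := by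
  have hp0 : 0 < p := by linarith
  choose σ hσ hσi hσN using exists_stronglyMeasurable_selection hκ f
  have hm : ∀ i, Measurable fun r => ‖inner ℂ (κ i r) f‖ₑ := fun i =>
    ((hκ i).inner stronglyMeasurable_const).measurable.enorm
  set G : ℕ → ℝ → ℝ≥0∞ := fun N r => (⨆ i, ⨆ (_ : i ≤ N), ‖inner ℂ (κ i r) f‖ₑ) ^ p with hG
  have hGm : ∀ N, Measurable (G N) := fun N =>
    (Measurable.iSup fun i => Measurable.iSup fun _ => hm i).pow_const p
  have hGmono : Monotone G := fun M N hMN r =>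
    ENNReal.rpow_le_rpow (iSup_mono fun i => iSup_mono' fun hi => ⟨hi.trans hMN, le_rfl⟩) hp0.le
  have hsup : ∀ r, (⨆ i, ‖inner ℂ (κ i r) f‖ₑ) ^ p ≤ ⨆ N, G N r := by
    intro r
    have h1 := (ENNReal.orderIsoRpow p hp0).map_iSup fun i => ‖inner ℂ (κ i r) f‖ₑ
    simp only [ENNReal.orderIsoRpow_apply] at h1
    rw [h1]
    refine iSup_mono fun i => ENNReal.rpow_le_rpow ?_ hp0.le
    exact le_iSup₂ (f := fun j (_ : j ≤ i) => ‖inner ℂ (κ j r) f‖ₑ) i le_rfl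
  refine (lintegral_mono hsup).trans ?_
  rw [lintegral_iSup hGm hGmono]
  refine iSup_le fun N => ?_
  -- The bounds are uniform over the indices, so the selected family `σ N` satisfies them too and
  -- the supremum becomes linear.
  refine (lintegral_mono fun r => ?_).trans (lintegral_enorm_inner_rpow_le (hσ N) (B := B)
    (fun r => ?_) hk (fun r s => ?_) hp f)
  · exact ENNReal.rpow_le_rpow (iSup₂_le fun i hi => hσN N i hi r) hp0.le
  · obtain ⟨i, hi⟩ := hσi N r
    rw [hi]
    exact hB i r
  · obtain ⟨i, hi⟩ := hσi N r
    obtain ⟨j, hj⟩ := hσi N s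
    rw [hi, hj]
    exact h i j r s

end Hilbert

/-! ### The inverse Fourier transform of integrable square-integrable functions -/

theorem integral_fourierInv_smul_eq {n : ℕ} {f g : Eucl n → ℂ} (hf : Integrable f)
    (hg : Integrable g) : ∫ ξ, 𝓕⁻ f ξ • g ξ = ∫ x, f x • 𝓕⁻ g x := by
  have h := VectorFourier.integral_fourierIntegral_smul_eq_flip (L := -innerₗ (Eucl n))
    (μ := volume) (ν := volume) Real.continuous_fourierChar
    (show Continuous fun p : Eucl n × Eucl n => -inner ℝ p.1 p.2 from continuous_inner.neg) hf hg
  have hflip : (-innerₗ (Eucl n)).flip = -innerₗ (Eucl n) := by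
    ext x y
    simp [real_inner_comm]
  rw [hflip] at h
  exact h

theorem continuous_fourierInv_of_integrable {n : ℕ} {f : Eucl n → ℂ} (hf : Integrable f) :
    Continuous (𝓕⁻ f) :=
  VectorFourier.fourierIntegral_continuous Real.continuous_fourierChar
    (show Continuous fun p : Eucl n × Eucl n => -inner ℝ p.1 p.2 from continuous_inner.neg) hf

/-- Both sides have the same integrals against smooth compactly supported functions: the `L²`
transform by its compatibility with tempered distributions, the integral by the multiplication
formula. -/
theorem fourierInv_coeFn_ae_eq {n : ℕ} (h : L2 n) (hi : Integrable h) :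
    ((𝓕⁻ h : L2 n) : Eucl n → ℂ) =ᵐ[volume] 𝓕⁻ (h : Eucl n → ℂ) := by
  refine ae_eq_of_integral_contDiff_smul_eq ((Lp.memLp _).locallyIntegrable (by norm_num))
    (continuous_fourierInv_of_integrable hi).locallyIntegrable fun g hg hgs => ?_
  have hg₁ : HasCompactSupport (Complex.ofRealCLM ∘ g) := hgs.comp_left rfl
  have hg₂ : ContDiff ℝ ∞ (Complex.ofRealCLM ∘ g) := by fun_prop
  set G : SchwartzMap (Eucl n) ℂ := hg₁.toSchwartzMap hg₂ with hG
  have hGg : ∀ x, G x = (g x : ℂ) := fun x => rfl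
  have h1 := congrArg (fun T => T G) (Lp.fourierInv_toTemperedDistribution_eq h)
  simp only [TemperedDistribution.fourierInv_apply, Lp.toTemperedDistribution_apply] at h1
  have h2 := integral_fourierInv_smul_eq G.integrable hi
  rw [SchwartzMap.fourierInv_coe, h2] at h1
  have h3 : ∀ F : Eucl n → ℂ, ∫ x, g x • F x = ∫ x, G x • F x := fun F =>
    integral_congr_ae (Filter.Eventually.of_forall fun x => by simp [hGg])
  rw [h3, h3, h1]

/-! ### The propagator as a family of functionals on `L²` -/

theorem continuous_lpSymbol {n : ℕ} (χ : Cutoff) (j : ℤ) :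
    Continuous (lpSymbol (n := n) χ j) := by
  have hc : Continuous χ.toFun := χ.smooth.continuous
  unfold lpSymbol
  fun_prop

theorem continuous_lpSymbol_two_pi {n : ℕ} (χ : Cutoff) (j : ℤ) :
    Continuous fun η : Eucl n => lpSymbol χ j ((2 * Real.pi) • η) :=
  (continuous_lpSymbol χ j).comp (continuous_const_smul _)

theorem hasCompactSupport_lpSymbol_two_pi {n : ℕ} (χ : Cutoff) (j : ℤ) :
    HasCompactSupport fun η : Eucl n => lpSymbol χ j ((2 * Real.pi) • η) := by
  have hpi := Real.pi_pos
  refine HasCompactSupport.intro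
    (isCompact_closedBall (0 : Eucl n) (2 / ((2 : ℝ) ^ (-j) * (2 * Real.pi)))) fun η hη => ?_
  have h1 : 2 / ((2 : ℝ) ^ (-j) * (2 * Real.pi)) < ‖η‖ := by simpa using hη
  rw [div_lt_iff₀ (by positivity)] at h1
  have h2 : 2 ≤ ‖(2 : ℝ) ^ (-j) • (2 * Real.pi) • η‖ := by
    rw [norm_smul, norm_smul, Real.norm_of_nonneg (by positivity),
      Real.norm_of_nonneg (by positivity)]
    linarith
  simp only [lpSymbol]
  rw [χ.eq_zero h2, χ.eq_zero (by linarith)]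
  simp

theorem star_lpSymbol {n : ℕ} (χ : Cutoff) (j : ℤ) (ξ : Eucl n) :
    (starRingEnd ℂ) (lpSymbol χ j ξ) = lpSymbol χ j ξ := by
  rw [lpSymbol, Complex.conj_ofReal]

theorem continuous_osc_two_pi {n : ℕ} (ε : Fin n → ℝ) (t : ℝ) (x : Eucl n) :
    Continuous fun η : Eucl n => osc ε t x ((2 * Real.pi) • η) := by
  have := continuous_quadForm ε
  unfold osc
  fun_prop

theorem memLp_wave {n : ℕ} (χ : Cutoff) (ε : Fin n → ℝ) (j : ℤ) (z : ℝ × Eucl n) :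
    MemLp (fun η : Eucl n => (starRingEnd ℂ) (osc ε z.1 z.2 ((2 * Real.pi) • η)) *
      lpSymbol χ j ((2 * Real.pi) • η)) 2 volume :=
  Continuous.memLp_of_hasCompactSupport
    ((Complex.continuous_conj.comp (continuous_osc_two_pi ε z.1 z.2)).mul
      (continuous_lpSymbol_two_pi χ j))
    (hasCompactSupport_lpSymbol_two_pi χ j).mul_left

/-- The element of `L²` whose inner product with `φ̂` is the value of `P_j W_±(t) φ` at `x`, where
`z = (t, x)`. -/
def wave {n : ℕ} (χ : Cutoff) (ε : Fin n → ℝ) (j : ℤ) (z : ℝ × Eucl n) : L2 n :=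
  (memLp_wave χ ε j z).toLp

theorem star_osc {n : ℕ} (ε : Fin n → ℝ) (t : ℝ) (x ξ : Eucl n) :
    (starRingEnd ℂ) (osc ε t x ξ) = osc ε (-t) (-x) ξ := by
  rw [osc, osc, ← Complex.exp_conj, map_mul, Complex.conj_I, Complex.conj_ofReal, inner_neg_left]
  congr 1
  push_cast
  ring

theorem osc_mul_osc {n : ℕ} (ε : Fin n → ℝ) (t s : ℝ) (x y ξ : Eucl n) :
    osc ε t x ξ * osc ε s y ξ = osc ε (t + s) (x + y) ξ := by
  rw [osc, osc, osc, ← Complex.exp_add, inner_add_left]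
  congr 1
  push_cast
  ring

/-- This identifies the `T T*` kernel: it depends only on the space-time difference. -/
theorem inner_wave_wave {n : ℕ} (χ : Cutoff) (ε : Fin n → ℝ) (j : ℤ) (z w : ℝ × Eucl n) :
    inner ℂ (wave χ ε j z) (wave χ ε j w) = propKernel χ ε j (z.1 - w.1) (z.2 - w.2) := by
  rw [L2.inner_def, propKernel]
  refine integral_congr_ae ?_
  filter_upwards [(memLp_wave χ ε j z).coeFn_toLp, (memLp_wave χ ε j w).coeFn_toLp] with η h1 h2
  rw [wave, wave, h1, h2, RCLike.inner_apply, map_mul, Complex.conj_conj, star_lpSymbol, star_osc,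
    sub_eq_add_neg, sub_eq_add_neg, ← osc_mul_osc]
  ring

theorem continuous_propKernel {n : ℕ} (χ : Cutoff) (ε : Fin n → ℝ) (j : ℤ) :
    Continuous fun z : ℝ × Eucl n => propKernel χ ε j z.1 z.2 := by
  have hψ : Continuous fun η : Eucl n =>
      lpSymbol χ j ((2 * Real.pi) • η) * lpSymbol χ j ((2 * Real.pi) • η) :=
    (continuous_lpSymbol_two_pi χ j).mul (continuous_lpSymbol_two_pi χ j)
  have hi : Integrable fun η : Eucl n =>
      lpSymbol χ j ((2 * Real.pi) • η) * lpSymbol χ j ((2 * Real.pi) • η) :=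
    hψ.integrable_of_hasCompactSupport (hasCompactSupport_lpSymbol_two_pi χ j).mul_left
  refine continuous_of_dominated (fun z => ?_) (fun z => Filter.Eventually.of_forall fun η => ?_)
    hi.norm (Filter.Eventually.of_forall fun η => ?_)
  · exact ((continuous_osc_two_pi ε z.1 z.2).mul hψ).aestronglyMeasurable
  · rw [norm_mul, norm_osc, one_mul]
  · unfold osc
    fun_prop

theorem norm_wave_sq {n : ℕ} (χ : Cutoff) (ε : Fin n → ℝ) (j : ℤ) (z : ℝ × Eucl n) :
    ‖wave χ ε j z‖ ^ 2 = (propKernel χ ε j 0 0).re := by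
  have h := inner_self_eq_norm_sq (𝕜 := ℂ) (wave χ ε j z)
  rw [inner_wave_wave, sub_self, sub_self] at h
  exact h.symm

/-- The norm is the same at all points, so `‖wave w - wave z‖² = 2 Re K(0) - 2 Re K(w - z)`, and
continuity of the scalar kernel suffices. -/
theorem continuous_wave {n : ℕ} (χ : Cutoff) (ε : Fin n → ℝ) (j : ℤ) :
    Continuous (wave χ ε j) := by
  rw [continuous_iff_continuousAt]
  intro z
  have hK : Continuous fun w : ℝ × Eucl n => propKernel χ ε j (w.1 - z.1) (w.2 - z.2) :=
    (continuous_propKernel χ ε j).comp (f := fun w : ℝ × Eucl n => (w.1 - z.1, w.2 - z.2))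
      (by fun_prop)
  rw [ContinuousAt, tendsto_iff_norm_sub_tendsto_zero]
  have h1 : ∀ w, ‖wave χ ε j w - wave χ ε j z‖
      = √(2 * (propKernel χ ε j 0 0).re - 2 * (propKernel χ ε j (w.1 - z.1) (w.2 - z.2)).re) := by
    intro w
    rw [← Real.sqrt_sq (norm_nonneg (wave χ ε j w - wave χ ε j z)), @norm_sub_sq ℂ, norm_wave_sq,
      norm_wave_sq, inner_wave_wave]
    congr 1
    simp only [RCLike.re_eq_complex_re]
    ring
  simp_rw [h1]
  have h2 : Continuous fun w : ℝ × Eucl n => √(2 * (propKernel χ ε j 0 0).re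
      - 2 * (propKernel χ ε j (w.1 - z.1) (w.2 - z.2)).re) := by fun_prop
  have h3 := h2.tendsto z
  simpa using h3

/-- The continuous representative of `P_j W_±(t) φ`. -/
def waveRep {n : ℕ} (χ : Cutoff) (ε : Fin n → ℝ) (j : ℤ) (φ : L2 n) (t : ℝ) (x : Eucl n) : ℂ :=
  inner ℂ (wave χ ε j (t, x)) (𝓕 φ)

theorem continuous_waveRep {n : ℕ} (χ : Cutoff) (ε : Fin n → ℝ) (j : ℤ) (φ : L2 n) :
    Continuous (Function.uncurry (waveRep χ ε j φ)) :=
  (continuous_wave χ ε j).inner continuous_const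

theorem osc_two_pi_eq {n : ℕ} (ε : Fin n → ℝ) (t : ℝ) (x η : Eucl n) :
    osc ε t x ((2 * Real.pi) • η) = Complex.exp (((2 * Real.pi * inner ℝ η x : ℝ) : ℂ) * Complex.I)
      * schrodingerSymbol ε t ((2 * Real.pi) • η) := by
  rw [osc, schrodingerSymbol, ← Complex.exp_add, inner_smul_right, real_inner_comm]
  congr 1
  push_cast
  ring

/-- The localized transform is a product of two `L²` functions, hence integrable, so its `L²`
inverse transform is given by the Fourier integral, which is the inner product with `wave`. -/
theorem waveRep_ae_eq {n : ℕ} (χ : Cutoff) (ε : Fin n → ℝ) (j : ℤ) (φ : L2 n) (t : ℝ) :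
    waveRep χ ε j φ t =ᵐ[volume] lpProj χ j (schrodinger ε t φ) := by
  set g : L2 n := (memLp_symbol_mul (isSymbol_schrodingerSymbol ε t) (𝓕 φ)).toLp with hg
  have hFg : 𝓕 (schrodinger ε t φ) = g := by
    rw [schrodinger, fourierMultiplier, ← hg]
    exact FourierTransform.fourier_fourierInv_eq g
  set h : L2 n := (memLp_symbol_mul (isSymbol_lpSymbol χ j) (𝓕 (schrodinger ε t φ))).toLp with hh
  have hhae : h =ᵐ[volume] fun η => lpSymbol χ j ((2 * Real.pi) • η) *
      (schrodingerSymbol ε t ((2 * Real.pi) • η) * (𝓕 φ : L2 n) η) := by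
    filter_upwards [(memLp_symbol_mul (isSymbol_lpSymbol χ j)
      (𝓕 (schrodinger ε t φ))).coeFn_toLp,
      (memLp_symbol_mul (isSymbol_schrodingerSymbol ε t) (𝓕 φ)).coeFn_toLp] with η h1 h2
    rw [h1, hFg, hg, h2]
  have hψ : MemLp (fun η : Eucl n => lpSymbol χ j ((2 * Real.pi) • η)) 2 volume :=
    (continuous_lpSymbol_two_pi χ j).memLp_of_hasCompactSupport
      (hasCompactSupport_lpSymbol_two_pi χ j)
  have hi : Integrable h :=
    (MemLp.integrable_mul hψ (memLp_symbol_mul (isSymbol_schrodingerSymbol ε t) (𝓕 φ))).congr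
      hhae.symm
  have hlp : lpProj χ j (schrodinger ε t φ) = 𝓕⁻ h := rfl
  rw [hlp]
  refine Filter.EventuallyEq.trans (Filter.Eventually.of_forall fun x => ?_)
    (fourierInv_coeFn_ae_eq h hi).symm
  rw [waveRep, L2.inner_def, Real.fourierInv_eq']
  refine integral_congr_ae ?_
  filter_upwards [hhae, (memLp_wave χ ε j (t, x)).coeFn_toLp] with η h1 h2
  rw [wave, h2, h1, RCLike.inner_apply, map_mul, Complex.conj_conj, star_lpSymbol, osc_two_pi_eq,
    smul_eq_mul]
  ring

theorem represents_waveRep {n : ℕ} (χ : Cutoff) (ε : Fin n → ℝ) (j : ℤ) (φ : L2 n) :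
    Represents (waveRep χ ε j φ) fun t => lpProj χ j (schrodinger ε t φ) :=
  ⟨(continuous_waveRep χ ε j φ).aestronglyMeasurable, waveRep_ae_eq χ ε j φ⟩

/-! ### Null sets in the coordinates `x = r e + v` -/

instance isAddHaarMeasure_hyperplaneMeasure {n : ℕ} (e : Eucl n) :
    (hyperplaneMeasure e).IsAddHaarMeasure :=
  inferInstanceAs (stdOrthonormalBasis ℝ (hyperplane e)).toBasis.addHaar.IsAddHaarMeasure

/-- The coordinates `(r, v, t) ↦ (t, r e + v)`. -/
def sliceEquiv {n : ℕ} {e : Eucl n} (he : ‖e‖ = 1) :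
    (ℝ × (hyperplane e × ℝ)) ≃L[ℝ] (ℝ × Eucl n) :=
  LinearEquiv.toContinuousLinearEquiv
    { toFun := fun z => (z.2.2, z.1 • e + (z.2.1 : Eucl n))
      map_add' := fun z w => by
        refine Prod.ext rfl ?_
        simp only [Prod.fst_add, Prod.snd_add, add_smul, Submodule.coe_add]
        abel
      map_smul' := fun c z => by
        refine Prod.ext rfl ?_
        simp [smul_smul]
      invFun := fun z => (inner ℝ e z.2,
        (⟨z.2 - inner ℝ e z.2 • e, by
          rw [Submodule.mem_orthogonal_singleton_iff_inner_right, inner_sub_right,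
            inner_smul_right, real_inner_self_eq_norm_sq, he]
          ring⟩, z.1))
      left_inv := fun z => by
        have h1 : inner ℝ e (z.2.1 : Eucl n) = 0 :=
          (Submodule.mem_orthogonal_singleton_iff_inner_right).mp z.2.1.2
        have h2 : inner ℝ e (z.1 • e + (z.2.1 : Eucl n)) = z.1 := by
          rw [inner_add_right, inner_smul_right, real_inner_self_eq_norm_sq, he, h1]
          ring
        refine Prod.ext h2 (Prod.ext (Subtype.ext ?_) rfl)
        simp only [h2, add_sub_cancel_left]
      right_inv := fun z => by
        refine Prod.ext rfl ?_
        simp }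

/-- The coordinates are a linear isomorphism, so product measure is carried to a Haar measure, which
has the null sets of Lebesgue measure; the rest is Fubini. -/
theorem ae_slice_of_ae {n : ℕ} {e : Eucl n} (he : ‖e‖ = 1) {q : ℝ × Eucl n → Prop}
    (hq : ∀ᵐ z, q z) :
    ∀ᵐ r : ℝ, ∀ᵐ y ∂(hyperplaneMeasure e).prod (volume : Measure ℝ),
      q (y.2, r • e + (y.1 : Eucl n)) := by
  set ν : Measure (ℝ × (hyperplane e × ℝ)) :=
    (volume : Measure ℝ).prod ((hyperplaneMeasure e).prod (volume : Measure ℝ)) with hν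
  have h1 : ν.map (sliceEquiv he) ≪ (volume : Measure (ℝ × Eucl n)) := by
    have : (volume : Measure (ℝ × Eucl n)).IsAddHaarMeasure := by
      rw [Measure.volume_eq_prod]
      infer_instance
    have h1 : ((hyperplaneMeasure e).prod (volume : Measure ℝ)).IsAddHaarMeasure :=
      Measure.prod.instIsAddHaarMeasure _ _
    have h2 : ν.IsAddHaarMeasure := Measure.prod.instIsAddHaarMeasure _ _
    have h3 : (ν.map (sliceEquiv he)).IsAddHaarMeasure :=
      (sliceEquiv he).isAddHaarMeasure_map ν
    rw [Measure.isAddLeftInvariant_eq_smul (ν.map (sliceEquiv he)) volume]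
    exact Measure.smul_absolutelyContinuous
  have h2 : ∀ᵐ z ∂ν, q (sliceEquiv he z) :=
    ae_of_ae_map (sliceEquiv he).continuous.measurable.aemeasurable (h1.ae_le hq)
  exact Measure.ae_ae_of_ae_prod h2

/-- Null slices give a null set only for measurable sets, so the comparison passes through a
measurable modification `m` of `u`. -/
theorem ae_eq_of_forall_ae_eq {n : ℕ} {u v : ℝ → Eucl n → ℂ}
    (hu : AEStronglyMeasurable (Function.uncurry u) (volume : Measure (ℝ × Eucl n)))
    (hv : Continuous (Function.uncurry v)) (h : ∀ t, u t =ᵐ[volume] v t) :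
    Function.uncurry u =ᵐ[volume] Function.uncurry v := by
  obtain ⟨m, hm, hum⟩ := hu
  refine hum.trans ?_
  have h1 : ∀ᵐ t : ℝ, ∀ᵐ x : Eucl n, Function.uncurry u (t, x) = m (t, x) :=
    Measure.ae_ae_of_ae_prod hum
  have hmeas : MeasurableSet {z : ℝ × Eucl n | m z = Function.uncurry v z}ᶜ :=
    (measurableSet_eq_fun hm.measurable hv.measurable).compl
  change (volume : Measure (ℝ × Eucl n)) {z | m z = Function.uncurry v z}ᶜ = 0
  rw [Measure.volume_eq_prod]
  refine Measure.measure_prod_null_of_ae_null hmeas ?_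
  filter_upwards [h1] with t ht
  change ∀ᵐ x : Eucl n, m (t, x) = Function.uncurry v (t, x)
  filter_upwards [ht, h t] with x h2 h3
  rw [← h2]
  exact h3

/-! ### The maximal function estimate -/

/-- Reduces the supremum over a hyperplane to a sequence, as the inductive measurable selection
requires. -/
theorem enorm_le_iSup_denseSeq {Y : Type*} [TopologicalSpace Y] [TopologicalSpace.SeparableSpace Y]
    [Nonempty Y] {f : Y → ℂ} (hf : Continuous f) (y : Y) :
    ‖f y‖ₑ ≤ ⨆ i, ‖f (TopologicalSpace.denseSeq Y i)‖ₑ := by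
  have hcl : IsClosed {y | ‖f y‖ₑ ≤ ⨆ i, ‖f (TopologicalSpace.denseSeq Y i)‖ₑ} :=
    isClosed_le hf.enorm continuous_const
  have hsub : Set.range (TopologicalSpace.denseSeq Y) ⊆
      {y | ‖f y‖ₑ ≤ ⨆ i, ‖f (TopologicalSpace.denseSeq Y i)‖ₑ} := by
    rintro _ ⟨i, rfl⟩
    exact le_iSup (fun i => ‖f (TopologicalSpace.denseSeq Y i)‖ₑ) i
  have := closure_minimal hsub hcl
  rw [(TopologicalSpace.denseRange_denseSeq Y).closure_range] at this
  exact this (Set.mem_univ y)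

/-- The point of `ℝ × ℝⁿ` with coordinates `(r, v, t)`, where `(v, t)` is the `i`-th member of a
dense sequence. -/
def slicePoint {n : ℕ} (e : Eucl n) (i : ℕ) (r : ℝ) : ℝ × Eucl n :=
  ((TopologicalSpace.denseSeq (hyperplane e × ℝ) i).2,
    r • e + ((TopologicalSpace.denseSeq (hyperplane e × ℝ) i).1 : Eucl n))

theorem mixedNorm_le_eLpNorm_iSup {n : ℕ} (χ : Cutoff) (ε : Fin n → ℝ) (j : ℤ) (φ : L2 n)
    {e : Eucl n} (he : ‖e‖ = 1) (p : ℝ≥0∞) {u : ℝ → Eucl n → ℂ}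
    (hu : Represents u fun t => lpProj χ j (schrodinger ε t φ)) :
    mixedNorm e p ⊤ u
      ≤ eLpNorm (fun r : ℝ => ⨆ i, ‖inner ℂ (wave χ ε j (slicePoint e i r)) (𝓕 φ)‖ₑ) p volume := by
  have hcont := continuous_waveRep χ ε j φ
  have hae := ae_eq_of_forall_ae_eq hu.1 hcont fun t =>
    (hu.2 t).trans (waveRep_ae_eq χ ε j φ t).symm
  refine eLpNorm_mono_enorm_ae ?_
  filter_upwards [ae_slice_of_ae he hae] with r hr
  rw [enorm_eq_self, enorm_eq_self, eLpNorm_exponent_top]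
  refine eLpNormEssSup_le_of_ae_enorm_bound ?_
  filter_upwards [hr] with y hy
  have h1 : u y.2 (r • e + (y.1 : Eucl n)) = waveRep χ ε j φ y.2 (r • e + (y.1 : Eucl n)) := hy
  rw [h1]
  have hc : Continuous fun y : hyperplane e × ℝ =>
      waveRep χ ε j φ y.2 (r • e + (y.1 : Eucl n)) :=
    hcont.comp (f := fun y : hyperplane e × ℝ => (y.2, r • e + (y.1 : Eucl n))) (by fun_prop)
  exact enorm_le_iSup_denseSeq hc y

/-- The chosen `v` and `t` drop out, so the kernel bound becomes a convolution majorant in `r - s`.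
-/
theorem inner_slicePoint_sub {n : ℕ} {e : Eucl n} (he : ‖e‖ = 1) (i l : ℕ) (r s : ℝ) :
    inner ℝ ((slicePoint e i r).2 - (slicePoint e l s).2) e = r - s := by
  have h : ∀ v : hyperplane e, inner ℝ (v : Eucl n) e = 0 := fun v =>
    (Submodule.mem_orthogonal_singleton_iff_inner_left).mp v.2
  simp only [slicePoint, inner_sub_left, inner_add_left, h, real_inner_smul_left,
    real_inner_self_eq_norm_sq, he]
  ring

theorem continuous_slicePoint {n : ℕ} (e : Eucl n) (i : ℕ) : Continuous (slicePoint e i) := by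
  unfold slicePoint
  fun_prop

/-- The `L^{p/2}` norm of the majorant of the kernel. -/
theorem lintegral_majorant_rpow_le {A c p : ℝ} (hA : 0 ≤ A) (hc : 0 < c) {n d : ℕ} (hp : 0 < p)
    (hdp : 6 ≤ d * p) :
    ∫⁻ s : ℝ, ENNReal.ofReal (A * c ^ n * (√(1 + c * |s|))⁻¹ ^ d) ^ (p / 2)
      ≤ ENNReal.ofReal ((A * c ^ n) ^ (p / 2) *
        (c⁻¹ * ∫ s : ℝ, (1 + ‖s‖) ^ (-(3 / 2) : ℝ))) := by
  have hi : Integrable fun s : ℝ => (1 + ‖s‖) ^ (-(3 / 2) : ℝ) :=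
    integrable_one_add_norm (by norm_num)
  have hi2 : Integrable fun s : ℝ => (A * c ^ n) ^ (p / 2) * (1 + ‖c * s‖) ^ (-(3 / 2) : ℝ) :=
    (hi.comp_mul_left' hc.ne').const_mul _
  have hval : ∫ s : ℝ, (A * c ^ n) ^ (p / 2) * (1 + ‖c * s‖) ^ (-(3 / 2) : ℝ)
      = (A * c ^ n) ^ (p / 2) * (c⁻¹ * ∫ s : ℝ, (1 + ‖s‖) ^ (-(3 / 2) : ℝ)) := by
    rw [integral_const_mul,
      Measure.integral_comp_mul_left (fun s : ℝ => (1 + ‖s‖) ^ (-(3 / 2) : ℝ)),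
      abs_of_pos (inv_pos.mpr hc), smul_eq_mul]
  rw [← hval, ofReal_integral_eq_lintegral_ofReal hi2
    (Filter.Eventually.of_forall fun s => by positivity)]
  refine lintegral_mono fun s => ?_
  simp only
  rw [ENNReal.ofReal_rpow_of_nonneg (by positivity) (by positivity)]
  refine ENNReal.ofReal_le_ofReal ?_
  rw [Real.mul_rpow (by positivity) (by positivity)]
  refine mul_le_mul_of_nonneg_left ?_ (by positivity)
  have hy : 1 ≤ 1 + c * |s| := by
    have := mul_nonneg hc.le (abs_nonneg s)
    linarith
  rw [norm_mul, Real.norm_of_nonneg hc.le, Real.norm_eq_abs, Real.sqrt_eq_rpow,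
    ← Real.rpow_neg (by linarith), ← Real.rpow_natCast, ← Real.rpow_mul (by positivity),
    ← Real.rpow_mul (by positivity)]
  -- The exponent is `dp/4 ≥ 3/2`, by `hdp`.
  exact Real.rpow_le_rpow_of_exponent_le hy (by linarith)

/-- The maximal function estimate along a dense sequence of points of the hyperplanes `x·e = r`. -/
theorem exists_eLpNorm_iSup_inner_wave_le (χ : Cutoff) :
    ∃ C : ℝ≥0, ∀ (n : ℕ) (p : ℝ≥0∞), 2 ≤ n → 2 ≤ p → 6 ≤ (n : ℝ≥0∞) * p →
      ∀ ε : Fin n → ℝ, (∀ i, ε i = 1 ∨ ε i = -1) →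
      ∀ (e : Eucl n), ‖e‖ = 1 → ∀ (j : ℤ) (φ : L2 n),
        ENNReal.ofReal ((2 : ℝ) ^ (-((n : ℝ) / 2 - (p⁻¹).toReal) * (j : ℝ))) *
          eLpNorm (fun r : ℝ => ⨆ i, ‖inner ℂ (wave χ ε j (slicePoint e i r)) (𝓕 φ)‖ₑ) p volume
            ≤ C * ‖φ‖ₑ := by
  obtain ⟨A, hA0, hA⟩ := exists_norm_propKernel_le χ
  set I : ℝ := ∫ s : ℝ, (1 + ‖s‖) ^ (-(3 / 2) : ℝ) with hI
  have hI0 : 0 ≤ I := integral_nonneg fun s => by positivity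
  -- The argument produces `√A · I^{1/p}`; replacing `I^{1/p}` by `1 + I` makes the constant
  -- independent of `p`.
  refine ⟨Real.toNNReal (√A * (1 + I)), fun n p hn hp hnp ε hε e he j φ => ?_⟩
  set c : ℝ := (2 : ℝ) ^ j with hc
  have hc0 : 0 < c := by positivity
  have hpow : ∀ a : ℝ, (2 : ℝ) ^ (a * (j : ℝ)) = c ^ a := by
    intro a
    rw [hc, ← Real.rpow_intCast, ← Real.rpow_mul (by norm_num), mul_comm]
  have hCeq : ((Real.toNNReal (√A * (1 + I)) : ℝ≥0) : ℝ≥0∞) = ENNReal.ofReal (√A * (1 + I)) := rfl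
  have hFφ : ‖(𝓕 φ : L2 n)‖ₑ = ‖φ‖ₑ := by
    rw [← ofReal_norm, ← ofReal_norm, Lp.norm_fourier_eq]
  have hsqrtc : √(A * c ^ n) = √A * c ^ ((n : ℝ) / 2) := by
    rw [Real.sqrt_mul hA0, Real.sqrt_eq_rpow (c ^ n), ← Real.rpow_natCast, ← Real.rpow_mul hc0.le]
    congr 2
    ring
  have hwave : ∀ z, ‖wave χ ε j z‖ ≤ √(A * c ^ n) := by
    intro z
    refine Real.le_sqrt_of_sq_le ?_
    rw [norm_wave_sq]
    have h1 := hA n 0 (by omega) (by omega) ε hε e he j 0 0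
    rw [pow_zero, mul_one] at h1
    exact (Complex.re_le_norm _).trans h1
  rw [hpow, hCeq]
  -- For `p = ∞` Cauchy–Schwarz suffices, with the kernel bound for `d = 0` giving the norm of
  -- `wave`.
  by_cases hptop : p = ⊤
  · subst hptop
    simp only [ENNReal.inv_top, ENNReal.toReal_zero, sub_zero]
    have h1 : eLpNorm (fun r : ℝ => ⨆ i, ‖inner ℂ (wave χ ε j (slicePoint e i r)) (𝓕 φ)‖ₑ) ⊤ volume
        ≤ ENNReal.ofReal (√A * c ^ ((n : ℝ) / 2)) * ‖φ‖ₑ := by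
      rw [eLpNorm_exponent_top]
      refine eLpNormEssSup_le_of_ae_enorm_bound (Filter.Eventually.of_forall fun r => ?_)
      rw [enorm_eq_self]
      refine iSup_le fun i => ?_
      rw [← ofReal_norm, ← hFφ, ← ofReal_norm (𝓕 φ : L2 n), ← ENNReal.ofReal_mul (by positivity)]
      refine ENNReal.ofReal_le_ofReal ((norm_inner_le_norm _ _).trans ?_)
      rw [← hsqrtc]
      exact mul_le_mul_of_nonneg_right (hwave _) (norm_nonneg _)
    refine (mul_le_mul_right h1 _).trans ?_
    rw [← mul_assoc, ← ENNReal.ofReal_mul (by positivity)]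
    refine mul_le_mul_left (ENNReal.ofReal_le_ofReal ?_) _
    have h2 : c ^ (-((n : ℝ) / 2)) * c ^ ((n : ℝ) / 2) = 1 := by
      rw [← Real.rpow_add hc0]
      simp
    calc _ = √A * (c ^ (-((n : ℝ) / 2)) * c ^ ((n : ℝ) / 2)) := by ring
      _ ≤ √A * (1 + I) := by
        rw [h2]
        gcongr
        linarith
  · set P : ℝ := p.toReal with hP
    have hpP : p = ENNReal.ofReal P := (ENNReal.ofReal_toReal hptop).symm
    have hP2 : 2 ≤ P := by
      have := ENNReal.toReal_mono hptop hp
      simpa using this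
    have hP0 : 0 < P := by linarith
    have hnP : 6 ≤ n * P := by
      have := ENNReal.toReal_mono (ENNReal.mul_ne_top (ENNReal.natCast_ne_top n) hptop) hnp
      rw [ENNReal.toReal_mul, ENNReal.toReal_natCast] at this
      simpa using this
    have hdP : 6 ≤ (min n 3 : ℕ) * P := by
      rcases le_total n 3 with h | h
      · rwa [min_eq_left h]
      · rw [min_eq_right h]
        push_cast
        linarith
    set k : ℝ → ℝ≥0∞ := fun s =>
      ENNReal.ofReal (A * c ^ n * (√(1 + c * |s|))⁻¹ ^ (min n 3)) with hk
    have hkm : Measurable k := by fun_prop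
    have hTT := lintegral_iSup_enorm_inner_rpow_le
      (κ := fun i r => wave χ ε j (slicePoint e i r))
      (fun i => ((continuous_wave χ ε j).comp (continuous_slicePoint e i)).stronglyMeasurable)
      (fun i r => hwave _) hkm (fun i l r s => by
        rw [inner_wave_wave, ← ofReal_norm]
        refine ENNReal.ofReal_le_ofReal ?_
        have h1 := hA n (min n 3) (min_le_left _ _) (min_le_right _ _) ε hε e he j
          ((slicePoint e i r).1 - (slicePoint e l s).1)
          ((slicePoint e i r).2 - (slicePoint e l s).2)
        rwa [inner_slicePoint_sub he] at h1) hP2 (𝓕 φ : L2 n)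
    have hK := lintegral_majorant_rpow_le hA0 hc0 (n := n) hP0 hdP
    have hp0 : p ≠ 0 := by
      intro h
      rw [hP, h] at hP0
      simp at hP0
    have hmain : eLpNorm (fun r : ℝ => ⨆ i, ‖inner ℂ (wave χ ε j (slicePoint e i r)) (𝓕 φ)‖ₑ)
        p volume ≤ ENNReal.ofReal (((A * c ^ n) ^ (P / 2) * (c⁻¹ * I)) ^ (1 / P)) * ‖φ‖ₑ := by
      rw [eLpNorm_eq_lintegral_rpow_enorm_toReal hp0 hptop, ← hP]
      simp only [enorm_eq_self]
      refine (ENNReal.rpow_le_rpow (hTT.trans (mul_le_mul_left hK _)) (by positivity)).trans ?_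
      rw [ENNReal.mul_rpow_of_nonneg _ _ (by positivity), ← ENNReal.rpow_mul,
        mul_one_div_cancel hP0.ne', ENNReal.rpow_one, hFφ,
        ENNReal.ofReal_rpow_of_nonneg (by positivity) (by positivity)]
    refine (mul_le_mul_right hmain _).trans ?_
    rw [← mul_assoc, ← ENNReal.ofReal_mul (by positivity)]
    refine mul_le_mul_left (ENNReal.ofReal_le_ofReal ?_) _
    rw [Real.mul_rpow (by positivity) (by positivity), Real.mul_rpow (by positivity) hI0,
      ← Real.rpow_mul (by positivity), show P / 2 * (1 / P) = 1 / 2 by field_simp,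
      ← Real.sqrt_eq_rpow, hsqrtc, ENNReal.toReal_inv, ← hP]
    -- The powers of `2^j` cancel exactly: `n/2` comes from the size of the kernel and `-1/p` from
    -- the width `2^{-j}` of the majorant.
    have h2 : c ^ (-((n : ℝ) / 2 - P⁻¹)) * (c ^ ((n : ℝ) / 2) * c⁻¹ ^ (1 / P)) = 1 := by
      rw [Real.inv_rpow hc0.le, ← Real.rpow_neg hc0.le, ← Real.rpow_add hc0, ← Real.rpow_add hc0]
      rw [show -((n : ℝ) / 2 - P⁻¹) + ((n : ℝ) / 2 + -(1 / P)) = 0 by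
        rw [one_div]
        ring, Real.rpow_zero]
    have hI1 : I ^ (1 / P) ≤ 1 + I := by
      have h3 : I ^ (1 / P) ≤ (1 + I) ^ (1 / P) :=
        Real.rpow_le_rpow hI0 (by linarith) (by positivity)
      have h4 : (1 + I) ^ (1 / P) ≤ (1 + I) ^ (1 : ℝ) :=
        Real.rpow_le_rpow_of_exponent_le (by linarith) (by
          rw [div_le_one hP0]
          linarith)
      rw [Real.rpow_one] at h4
      exact h3.trans h4
    calc _ = √A * (c ^ (-((n : ℝ) / 2 - P⁻¹)) * (c ^ ((n : ℝ) / 2) * c⁻¹ ^ (1 / P)))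
          * I ^ (1 / P) := by ring
      _ ≤ √A * (1 + I) := by
        rw [h2, mul_one]
        gcongr

end NonellipticSchrodinger

end

theorem lemma2p3 (χ : NonellipticSchrodinger.Cutoff) :
    ∃ C : ℝ≥0, ∀ (n : ℕ) (p : ℝ≥0∞), 2 ≤ n → 2 ≤ p → 6 ≤ (n : ℝ≥0∞) * p →
      ∀ ε : Fin n → ℝ, (∀ i, ε i = 1 ∨ ε i = -1) →
      ∀ (e : EuclideanSpace ℝ (Fin n)), ‖e‖ = 1 →
      ∀ (j : ℤ) (φ : Lp ℂ 2 (volume : Measure (EuclideanSpace ℝ (Fin n)))),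
        (∃ u : ℝ → EuclideanSpace ℝ (Fin n) → ℂ, Continuous (Function.uncurry u) ∧
          NonellipticSchrodinger.Represents u fun t =>
            NonellipticSchrodinger.lpProj χ j (NonellipticSchrodinger.schrodinger ε t φ)) ∧
        ∀ u : ℝ → EuclideanSpace ℝ (Fin n) → ℂ,
          NonellipticSchrodinger.Represents u (fun t =>
            NonellipticSchrodinger.lpProj χ j (NonellipticSchrodinger.schrodinger ε t φ)) →
          ENNReal.ofReal ((2 : ℝ) ^ (-((n : ℝ) / 2 - (p⁻¹).toReal) * (j : ℝ))) *
              NonellipticSchrodinger.mixedNorm e p ∞ u ≤ C * ‖φ‖ₑ := by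
  obtain ⟨C, hC⟩ := NonellipticSchrodinger.exists_eLpNorm_iSup_inner_wave_le χ
  refine ⟨C, fun n p hn hp hnp ε hε e he j φ =>
    ⟨⟨NonellipticSchrodinger.waveRep χ ε j φ,
      NonellipticSchrodinger.continuous_waveRep χ ε j φ,
      NonellipticSchrodinger.represents_waveRep χ ε j φ⟩, fun u hu => ?_⟩⟩
  exact (mul_le_mul_right (NonellipticSchrodinger.mixedNorm_le_eLpNorm_iSup χ ε j φ he p hu)
    _).trans (hC n p hn hp hnp ε hε e he j φ)
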